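/- Let $D^{1,2}(\mathbb{R}^3)$ be the space of real-valued functions $u \in L^6(\mathbb{R}^3)$ whose weak gradient satisfies $|\nabla u| \in L^2(\mathbb{R}^3)$, and let $$E(\mathbb{R}^3) = \Big\{ u \in D^{1,2}(\mathbb{R}^3) : \int_{\mathbb{R}^3}\int_{\mathbb{R}^3} \frac{u(x)^2\, u(y)^2}{|x-y|}\, dx\, dy < +\infty \Big\}.$$ Then $E(\mathbb{R}^3) \subset L^p(\mathbb{R}^3)$ for every $p \in [3,6)$. On the other hand, for every $p \in (0,3)$ the inclusion $E(\mathbb{R}^3) \subset L^p(\mathbb{R}^3)$ does not hold, i.e. there is $u \in E(\mathbb{R}^3)$ with $\int_{\mathbb{R}^3} |u|^p\, dx = +\infty$. -/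

import Mathlib

open MeasureTheory
open scoped ENNReal ContDiff

/-- Three-dimensional space with the Euclidean norm and Lebesgue measure. -/
abbrev R3 : Type := EuclideanSpace ℝ (Fin 3)

/-- `G` is the weak (distributional) gradient of `u` on `ℝ³`: both are locally integrable and
`∫ u ∂_v φ = - ∫ ⟨G, v⟩ φ` for every test function `φ ∈ C₀^∞(ℝ³)` and every direction `v`. -/
structure HasWeakGradient (u : R3 → ℝ) (G : R3 → R3) : Prop where
  locallyIntegrable : LocallyIntegrable u volume
  locallyIntegrable_grad : LocallyIntegrable G volume
  integral_eq : ∀ φ : R3 → ℝ, ContDiff ℝ ∞ φ → HasCompactSupport φ → ∀ v : R3,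
    ∫ x, u x * fderiv ℝ φ x v = - ∫ x, inner ℝ (G x) v * φ x

/-- `D^{1,2}(ℝ³) = {u ∈ L⁶(ℝ³) : |∇u| ∈ L²(ℝ³)}`, on the level of representatives. -/
def spaceD12 : Set (R3 → ℝ) :=
  {u | MemLp u 6 volume ∧ ∃ G : R3 → R3, HasWeakGradient u G ∧ MemLp G 2 volume}

/-- The Coulomb energy `∫∫ u(x)² u(y)² / |x - y| dx dy`, with values in `[0, ∞]`.
The diagonal, where the quotient is `0` by convention, is a null set. -/
noncomputable def coulombEnergy (u : R3 → ℝ) : ℝ≥0∞ :=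
  ∫⁻ x : R3, ∫⁻ y : R3, ENNReal.ofReal (u x ^ 2 * u y ^ 2 / ‖x - y‖)

/-- `E(ℝ³)`: the functions in `D^{1,2}(ℝ³)` with finite Coulomb energy. -/
def spaceE : Set (R3 → ℝ) :=
  {u | u ∈ spaceD12 ∧ coulombEnergy u < (⊤ : ℝ≥0∞)}

/-- `L^p(ℝ³)`, on the level of representatives. For `0 < p < ∞` this means measurability almost
everywhere together with `∫ |u|^p < ∞`. -/
def spaceLp (p : ℝ≥0∞) : Set (R3 → ℝ) :=
  {u | MemLp u p volume}

/-! For `p = 3`, write `A_k` for averaging over balls of radius `2^k` and `N` for the maximal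
function of `|G|`, with `G` the weak gradient of `u`. Two facts compete. Integrating along rays
gives `|u| ≤ A_k|u| + 8 · 2^k N` almost everywhere (`HasWeakGradient.ae_enorm_le`), and `N ∈ L²` by
the maximal theorem. The kernel `1/|x - y|` dominates, up to a constant, the sum over `k` of
`2^(-k)` on `|x - y| < 2^(k+1)`, and each summand dominates `2^(2k)` times the kernel of `A_k A_k`.
As `A_k` is symmetric, the Coulomb energy controls the sum of `2^(2k) ∫ (A_k u²)²`
(`tsum_lintegral_avgBy_sq_le`). By Cauchy–Schwarz, `Q = ∑ 2^(2k) (A_k|u|)⁴` is then integrable. At a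
point, take `2^k` comparable to `|u|/N`, small enough that the gradient term is at most `|u|/2`.
Then `A_k|u| ≥ |u|/2`, so `|u|⁶ ≲ N² Q` and `|u|³ ≲ N² + Q`, which is integrable
(`cube_le_of_forall_dyadic`). The range `3 ≤ p < 6` follows by interpolation with `L⁶`.

For `p < 3`, superpose bumps of width `R n` and height `(R n)^(-2)`. With this height the squared
`L²` norm of the gradient and the Coulomb self-energy both scale like `(R n)^(-3)`, while the
integral of the `p`-th power scales like `(R n)^(3-2p)`. Exponentially distant centres make the
mutual energies summable, and a power law for `R n` makes the first series converge and the second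
diverge (`exists_radii`). -/

/-! ### Dyadic sums in `[0, ∞]`. -/

theorem ofReal_two_zpow (k : ℤ) : ENNReal.ofReal ((2 : ℝ) ^ k) = (2 : ℝ≥0∞) ^ k := by
  have h : (2 : ℝ≥0∞) = ((2 : NNReal) : ℝ≥0∞) := rfl
  rw [h, ← ENNReal.coe_zpow (by norm_num), ENNReal.ofReal]
  congr 1
  ext
  rw [Real.coe_toNNReal _ (by positivity)]
  push_cast
  rfl

theorem two_zpow_ne_zero (k : ℤ) : (2 : ℝ≥0∞) ^ k ≠ 0 :=
  (ENNReal.zpow_pos (by norm_num) (by norm_num) k).ne'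

theorem two_zpow_ne_top (k : ℤ) : (2 : ℝ≥0∞) ^ k ≠ ⊤ :=
  (ENNReal.zpow_lt_top (by norm_num) (by norm_num) k).ne

theorem two_zpow_mono {j k : ℤ} (h : j ≤ k) : (2 : ℝ≥0∞) ^ j ≤ 2 ^ k :=
  ENNReal.zpow_le_of_le (by norm_num) h

theorem two_zpow_add (j k : ℤ) : (2 : ℝ≥0∞) ^ (j + k) = 2 ^ j * 2 ^ k :=
  ENNReal.zpow_add (by norm_num) (by norm_num) j k

/-- The dyadic numbers below `s` sum to at most `2 s`. -/
theorem tsum_two_zpow_lt_le (s : ℝ≥0∞) :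
    ∑' k : ℤ, (if (2 : ℝ≥0∞) ^ k < s then (2 : ℝ≥0∞) ^ k else 0) ≤ 2 * s := by
  rcases eq_or_ne s 0 with rfl | h0
  · simp
  rcases eq_or_ne s ⊤ with rfl | ht
  · simp
  obtain ⟨m, hm1, hm2⟩ := ENNReal.exists_mem_Ioc_zpow h0 ht (y := 2) (by norm_num) (by norm_num)
  -- With `2^m < s ≤ 2^(m+1)`, only exponents `k ≤ m` contribute; writing `k = m - n` leaves a
  -- geometric series.
  have hinj : Function.Injective (fun n : ℕ => m - (n : ℤ)) := by
    intro a b h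
    simpa using h
  rw [← hinj.tsum_eq]
  · calc ∑' n : ℕ, (if (2 : ℝ≥0∞) ^ (m - (n : ℤ)) < s then (2 : ℝ≥0∞) ^ (m - (n : ℤ)) else 0)
        ≤ ∑' n : ℕ, (2 : ℝ≥0∞) ^ m * (2⁻¹) ^ n := by
          refine ENNReal.tsum_le_tsum fun n => ?_
          split_ifs
          · rw [sub_eq_add_neg, two_zpow_add, ENNReal.zpow_neg, zpow_natCast, ENNReal.inv_pow]
          · exact zero_le
      _ = 2 * 2 ^ m := by
          rw [ENNReal.tsum_mul_left, ENNReal.tsum_geometric, ENNReal.one_sub_inv_two, inv_inv,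
            mul_comm]
      _ ≤ 2 * s := by gcongr
  · intro k hk
    have hk' : (2 : ℝ≥0∞) ^ k < s := by
      by_contra h
      simp [h] at hk
    have : k < m + 1 := by
      by_contra h
      exact absurd (hk'.trans_le (hm2.trans (two_zpow_mono (not_lt.mp h)))) (lt_irrefl _)
    refine ⟨(m - k).toNat, ?_⟩
    simp only
    omega

/-- Comparison of a square with its dyadic layers. -/
theorem sq_le_tsum_two_zpow_lt (s : ℝ≥0∞) :
    s ^ 2 ≤ 4 * ∑' k : ℤ, (if (2 : ℝ≥0∞) ^ k < s then ((2 : ℝ≥0∞) ^ k) ^ 2 else 0) := by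
  rcases eq_or_ne s 0 with rfl | h0
  · simp
  rcases eq_or_ne s ⊤ with rfl | ht
  · suffices h : ∑' k : ℤ, (if (2 : ℝ≥0∞) ^ k < ⊤ then ((2 : ℝ≥0∞) ^ k) ^ 2 else 0) = ⊤ by
      rw [h]; simp
    refine top_unique (ENNReal.le_of_forall_nnreal_lt fun r _ => ?_)
    obtain ⟨n, hn⟩ := ENNReal.exists_nat_gt (ENNReal.coe_ne_top (r := r))
    refine le_trans ?_ (ENNReal.le_tsum (n : ℤ))
    rw [if_pos (two_zpow_ne_top _).lt_top, zpow_natCast]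
    refine hn.le.trans ?_
    have h1 : (n : ℝ≥0∞) ≤ 2 ^ n := by exact_mod_cast (Nat.lt_two_pow_self).le
    refine h1.trans (le_self_pow (one_le_pow₀ (by norm_num)) (by norm_num))
  · obtain ⟨m, hm1, hm2⟩ := ENNReal.exists_mem_Ioc_zpow h0 ht (y := 2) (by norm_num) (by norm_num)
    calc s ^ 2 ≤ (2 ^ (m + 1)) ^ 2 := by gcongr
      _ = 4 * (2 ^ m) ^ 2 := by rw [two_zpow_add, zpow_one]; ring
      _ ≤ _ := by
        gcongr
        refine le_trans ?_ (ENNReal.le_tsum m)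
        rw [if_pos hm1]

/-! ### Averages over balls. -/

/-- The average of `g (x + ·)` with respect to `ν`. -/
noncomputable def avgBy (ν : Measure R3) (g : R3 → ℝ≥0∞) (x : R3) : ℝ≥0∞ :=
  ∫⁻ z, g (x + z) ∂ν

theorem measurable_avgBy (ν : Measure R3) [SFinite ν] {g : R3 → ℝ≥0∞} (hg : Measurable g) :
    Measurable (avgBy ν g) :=
  Measurable.lintegral_prod_right' (f := fun p : R3 × R3 => g (p.1 + p.2)) (by fun_prop)

theorem avgBy_mono (ν : Measure R3) {g h : R3 → ℝ≥0∞} (hgh : ∀ x, g x ≤ h x) (x : R3) :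
    avgBy ν g x ≤ avgBy ν h x :=
  lintegral_mono fun _ => hgh _

/-- Translations commute, so this is Tonelli. It lets ball averages pass through mollification. -/
theorem avgBy_comm (ν ν' : Measure R3) [SFinite ν] [SFinite ν'] {g : R3 → ℝ≥0∞}
    (hg : Measurable g) (x : R3) : avgBy ν (avgBy ν' g) x = avgBy ν' (avgBy ν g) x := by
  unfold avgBy
  rw [lintegral_lintegral_swap]
  · simp only [add_right_comm]
  · exact (by fun_prop : Measurable fun p : R3 × R3 => g (x + p.1 + p.2)).aemeasurable

theorem avgBy_add_const (ν : Measure R3) [IsProbabilityMeasure ν] {g : R3 → ℝ≥0∞}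
    (c : ℝ≥0∞) (x : R3) : avgBy ν (fun y => g y + c) x = avgBy ν g x + c := by
  unfold avgBy
  rw [lintegral_add_right _ measurable_const]
  simp

/-- Cauchy–Schwarz against the constant `1`. -/
theorem avgBy_sq_le (ν : Measure R3) [IsProbabilityMeasure ν] {g : R3 → ℝ≥0∞}
    (hg : Measurable g) (x : R3) : avgBy ν g x ^ 2 ≤ avgBy ν (fun y => g y ^ 2) x := by
  have h := ENNReal.lintegral_mul_le_Lp_mul_Lq ν (Real.HolderConjugate.two_two)
    (f := fun z => g (x + z)) (g := fun _ => 1) (by fun_prop) aemeasurable_const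
  simp only [Pi.mul_apply, mul_one, ENNReal.one_rpow, lintegral_const, measure_univ] at h
  unfold avgBy
  calc (∫⁻ z, g (x + z) ∂ν) ^ 2 ≤ ((∫⁻ z, g (x + z) ^ (2 : ℝ) ∂ν) ^ (1 / 2 : ℝ)) ^ 2 := by
        gcongr
    _ = _ := by
        rw [← ENNReal.rpow_natCast, ← ENNReal.rpow_mul]
        norm_num

/-- The uniform probability measure on the ball of radius `r` about the origin. -/
noncomputable def ballMeasure (r : ℝ) : Measure R3 :=
  (volume (Metric.ball (0 : R3) r))⁻¹ • volume.restrict (Metric.ball 0 r)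

theorem volume_ball_ne_zero (x : R3) {r : ℝ} (hr : 0 < r) : volume (Metric.ball x r) ≠ 0 :=
  (Metric.measure_ball_pos _ _ hr).ne'

theorem volume_ball_ne_top (x : R3) (r : ℝ) : volume (Metric.ball x r) ≠ ⊤ :=
  measure_ball_lt_top.ne

theorem volume_ball_mul (x y : R3) {t r : ℝ} (ht : 0 ≤ t) (hr : 0 ≤ r) :
    volume (Metric.ball x (t * r)) = ENNReal.ofReal (t ^ 3) * volume (Metric.ball y r) := by
  rw [Measure.addHaar_ball _ _ (mul_nonneg ht hr), Measure.addHaar_ball _ y hr,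
    finrank_euclideanSpace_fin, mul_pow, ENNReal.ofReal_mul (by positivity), mul_assoc]

instance sFinite_ballMeasure (r : ℝ) : SFinite (ballMeasure r) := by
  unfold ballMeasure; infer_instance

theorem isProbabilityMeasure_ballMeasure {r : ℝ} (hr : 0 < r) :
    IsProbabilityMeasure (ballMeasure r) := by
  constructor
  simp only [ballMeasure, Measure.smul_apply, Measure.restrict_apply_univ, smul_eq_mul]
  exact ENNReal.inv_mul_cancel (volume_ball_ne_zero _ hr) (volume_ball_ne_top _ _)

instance isProbabilityMeasure_ballMeasure_zpow (k : ℤ) :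
    IsProbabilityMeasure (ballMeasure ((2 : ℝ) ^ k)) :=
  isProbabilityMeasure_ballMeasure (by positivity)

theorem avgBy_ballMeasure (r : ℝ) (g : R3 → ℝ≥0∞) (x : R3) :
    avgBy (ballMeasure r) g x
      = (volume (Metric.ball x r))⁻¹ * ∫⁻ y in Metric.ball x r, g y := by
  unfold avgBy ballMeasure
  rw [lintegral_smul_measure, smul_eq_mul]
  congr 1
  · rw [Measure.addHaar_ball_center volume x]
  · rw [← lintegral_indicator measurableSet_ball, ← lintegral_indicator measurableSet_ball,
      ← lintegral_add_left_eq_self ((Metric.ball x r).indicator g) x]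
    congr 1
    ext z
    simp [Set.indicator]

/-- The larger ball contains the smaller one and has at most `2³ = 8` times its volume. -/
theorem avgBy_ballMeasure_le (s r : ℝ) (hs : 0 < s) (hsr : s ≤ r) (hrs : r ≤ 2 * s)
    (g : R3 → ℝ≥0∞) (x : R3) :
    avgBy (ballMeasure s) g x ≤ 8 * avgBy (ballMeasure r) g x := by
  rw [avgBy_ballMeasure, avgBy_ballMeasure, ← mul_assoc]
  gcongr
  have h : volume (Metric.ball x r) ≤ 8 * volume (Metric.ball x s) := by
    refine (measure_mono (Metric.ball_subset_ball hrs)).trans ?_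
    rw [volume_ball_mul x x (by norm_num) hs.le]
    norm_num
  rw [ENNReal.inv_le_iff_le_mul (fun _ => volume_ball_ne_zero _ hs)
    (fun h => absurd h (volume_ball_ne_top _ _))]
  rw [← mul_assoc, mul_comm (volume _), ← div_eq_mul_inv, ENNReal.le_div_iff_mul_le]
  · rwa [one_mul]
  · exact Or.inl (volume_ball_ne_zero _ (hs.trans_le hsr))
  · exact Or.inl (volume_ball_ne_top _ _)

/-! ### The maximal function and its weak `(1, 1)` and `L²` bounds. -/

/-- The centred dyadic Hardy–Littlewood maximal function. -/
noncomputable def dyadicMaximal (g : R3 → ℝ≥0∞) (x : R3) : ℝ≥0∞ :=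
  ⨆ k : ℤ, avgBy (ballMeasure ((2 : ℝ) ^ k)) g x

theorem measurable_dyadicMaximal {g : R3 → ℝ≥0∞} (hg : Measurable g) :
    Measurable (dyadicMaximal g) :=
  Measurable.iSup fun _ => measurable_avgBy _ hg

/-- Every radius is within a factor two of the next dyadic one. Arbitrary radii are needed because
the ray integrals produce balls of radius `t * r`. -/
theorem avgBy_ballMeasure_le_dyadicMaximal {r : ℝ} (hr : 0 < r) (g : R3 → ℝ≥0∞) (x : R3) :
    avgBy (ballMeasure r) g x ≤ 8 * dyadicMaximal g x := by
  obtain ⟨m, hm1, hm2⟩ := exists_mem_Ioc_zpow hr (one_lt_two)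
  refine (avgBy_ballMeasure_le r (2 ^ (m + 1)) hr hm2 ?_ g x).trans ?_
  · rw [zpow_add_one₀ (by norm_num)]
    linarith
  · gcongr
    exact le_iSup (fun k : ℤ => avgBy (ballMeasure ((2 : ℝ) ^ k)) g x) (m + 1)

/-- The weak type `(1, 1)` inequality for the maximal function. -/
theorem mul_volume_dyadicMaximal_gt_le (g : R3 → ℝ≥0∞) {c : ℝ≥0∞} (hc : c ≠ 0) (hc' : c ≠ ⊤) :
    c * volume {x | c < dyadicMaximal g x} ≤ 64 * ∫⁻ x, g x := by
  rcases eq_or_ne (∫⁻ x, g x) ⊤ with hI | hI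
  · rw [hI]; simp
  set t : Set R3 := {x | c < dyadicMaximal g x}
  have hex : ∀ x : R3, ∃ r : ℝ, 0 < r ∧
      (x ∈ t → c * volume (Metric.ball x r) ≤ ∫⁻ y in Metric.ball x r, g y) := by
    intro x
    by_cases hx : x ∈ t
    · obtain ⟨k, hk⟩ := lt_iSup_iff.mp (show c < ⨆ k : ℤ, _ from hx)
      have hpos : (0 : ℝ) < 2 ^ k := by positivity
      refine ⟨2 ^ k, hpos, fun _ => ?_⟩
      rw [avgBy_ballMeasure, mul_comm, ← div_eq_mul_inv] at hk
      exact (ENNReal.le_div_iff_mul_le (Or.inl (volume_ball_ne_zero _ hpos))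
        (Or.inl (volume_ball_ne_top _ _))).mp hk.le
    · exact ⟨1, one_pos, fun h => absurd h hx⟩
  choose r hr0 hr using hex
  -- The covering lemma needs bounded radii: a selected ball satisfies `c |B(0,1)| r³ ≤ ∫ g`, that
  -- is, `r³ ≤ K`.
  set K : ℝ≥0∞ := (∫⁻ x, g x) / (c * volume (Metric.ball (0 : R3) 1))
  have hcv : c * volume (Metric.ball (0 : R3) 1) ≠ 0 :=
    mul_ne_zero hc (volume_ball_ne_zero _ one_pos)
  have hcv' : c * volume (Metric.ball (0 : R3) 1) ≠ ⊤ :=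
    ENNReal.mul_ne_top hc' (volume_ball_ne_top _ _)
  have hK : K ≠ ⊤ := ENNReal.div_ne_top hI hcv
  have hbd : ∀ x ∈ t, r x ≤ max 1 K.toReal := by
    intro x hx
    have h1 := (hr x hx).trans (setLIntegral_le_lintegral _ _)
    rw [← mul_one (r x), volume_ball_mul x 0 (hr0 x).le zero_le_one, mul_left_comm] at h1
    have h2 : ENNReal.ofReal (r x ^ 3) ≤ K :=
      (ENNReal.le_div_iff_mul_le (Or.inl hcv) (Or.inl hcv')).mpr h1
    have h3 : r x ^ 3 ≤ K.toReal := (ENNReal.ofReal_le_iff_le_toReal hK).mp h2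
    rcases le_total (r x) 1 with h | h
    · exact le_max_of_le_left h
    · exact le_max_of_le_right ((le_self_pow₀ h (by norm_num)).trans h3)
  -- Enlarging the disjoint balls by the factor `4` multiplies volumes by `4³`, which is the
  -- constant `64`.
  obtain ⟨u, hut, hdisj, hcov⟩ := Vitali.exists_disjoint_subfamily_covering_enlargement_ball
    t (fun x : R3 => x) r _ hbd 4 (by norm_num)
  have hcount : u.Countable := hdisj.countable_of_isOpen (fun _ _ => Metric.isOpen_ball)
    (fun x _ => ⟨x, Metric.mem_ball_self (hr0 x)⟩)
  have hsub : t ⊆ ⋃ b ∈ u, Metric.ball b (4 * r b) := by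
    intro x hx
    obtain ⟨b, hb, hxb⟩ := hcov x hx
    exact Set.mem_biUnion hb (hxb (Metric.mem_ball_self (hr0 x)))
  calc c * volume t ≤ c * ∑' b : u, volume (Metric.ball (b : R3) (4 * r b)) := by
        gcongr
        exact (measure_mono hsub).trans (measure_biUnion_le _ hcount _)
    _ = 64 * ∑' b : u, c * volume (Metric.ball (b : R3) (r b)) := by
        rw [← ENNReal.tsum_mul_left, ← ENNReal.tsum_mul_left]
        refine tsum_congr fun b => ?_
        rw [volume_ball_mul _ (b : R3) (by norm_num) (hr0 _).le]
        norm_num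
        ring
    _ ≤ 64 * ∑' b : u, ∫⁻ y in Metric.ball (b : R3) (r b), g y := by
        gcongr with b
        exact hr _ (hut b.2)
    _ = 64 * ∫⁻ y in ⋃ b ∈ u, Metric.ball b (r b), g y := by
        rw [lintegral_biUnion hcount (fun _ _ => measurableSet_ball) hdisj]
    _ ≤ 64 * ∫⁻ y, g y := by
        gcongr
        exact Measure.restrict_le_self

/-- The `L²` bound for the maximal function. -/
theorem lintegral_dyadicMaximal_sq_le {g : R3 → ℝ≥0∞} (hg : Measurable g) :
    ∫⁻ x, dyadicMaximal g x ^ 2 ≤ 2048 * ∫⁻ x, g x ^ 2 := by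
  -- Truncate `g` at half the level `2^j`. The small part has averages at most `c`, so the large
  -- part `h` must have maximal function above `c`, and the weak type bound applies to `h`.
  have hlevel : ∀ j : ℤ, (2 : ℝ≥0∞) ^ j * volume {x | (2 : ℝ≥0∞) ^ j < dyadicMaximal g x}
      ≤ 128 * ∫⁻ x, if (2 : ℝ≥0∞) ^ j < 2 * g x then g x else 0 := by
    intro j
    set c : ℝ≥0∞ := 2 ^ (j - 1)
    have hc : (2 : ℝ≥0∞) ^ j = 2 * c := by
      rw [show j = 1 + (j - 1) by ring, two_zpow_add, zpow_one]
    set h : R3 → ℝ≥0∞ := fun x => if (2 : ℝ≥0∞) ^ j < 2 * g x then g x else 0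
    have hgh : ∀ x, g x ≤ h x + c := by
      intro x
      simp only [h]
      split_ifs with hx
      · exact le_self_add
      · rw [hc, not_lt] at hx
        rw [zero_add]
        exact (ENNReal.mul_le_mul_iff_right (by norm_num) (by norm_num)).mp hx
    have hmax : ∀ x, dyadicMaximal g x ≤ dyadicMaximal h x + c := by
      intro x
      refine iSup_le fun k => ?_
      refine (avgBy_mono _ hgh x).trans ?_
      rw [avgBy_add_const]
      gcongr
      exact le_iSup (fun k : ℤ => avgBy (ballMeasure ((2 : ℝ) ^ k)) h x) k
    have hsub : {x | (2 : ℝ≥0∞) ^ j < dyadicMaximal g x} ⊆ {x | c < dyadicMaximal h x} := by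
      intro x hx
      have h1 := lt_of_lt_of_le (show (2 : ℝ≥0∞) ^ j < dyadicMaximal g x from hx) (hmax x)
      rw [hc, two_mul] at h1
      exact lt_of_add_lt_add_right h1
    calc (2 : ℝ≥0∞) ^ j * volume {x | (2 : ℝ≥0∞) ^ j < dyadicMaximal g x}
        ≤ 2 * (c * volume {x | c < dyadicMaximal h x}) := by
          rw [hc, mul_assoc]
          gcongr 2 * (c * ?_)
          rw [← hc]
          exact measure_mono hsub
      _ ≤ 2 * (64 * ∫⁻ x, h x) := by
          gcongr 2 * ?_
          exact mul_volume_dyadicMaximal_gt_le h (two_zpow_ne_zero _) (two_zpow_ne_top _)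
      _ = _ := by rw [← mul_assoc]; norm_num
  have hmeas := measurable_dyadicMaximal hg
  -- Dyadic layer-cake argument: after exchanging sum and integral, the levels with `2^j < 2 g` sum
  -- to at most `4 g`, giving `4 · 128 · 4 = 2048`.
  calc ∫⁻ x, dyadicMaximal g x ^ 2
      ≤ ∫⁻ x, 4 * ∑' j : ℤ,
          (if (2 : ℝ≥0∞) ^ j < dyadicMaximal g x then ((2 : ℝ≥0∞) ^ j) ^ 2 else 0) :=
        lintegral_mono fun x => sq_le_tsum_two_zpow_lt _
    _ = 4 * ∑' j : ℤ, (2 : ℝ≥0∞) ^ j *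
          ((2 : ℝ≥0∞) ^ j * volume {x | (2 : ℝ≥0∞) ^ j < dyadicMaximal g x}) := by
        have hms : ∀ j : ℤ, MeasurableSet {x | (2 : ℝ≥0∞) ^ j < dyadicMaximal g x} :=
          fun j => measurableSet_lt measurable_const hmeas
        rw [lintegral_const_mul _ (Measurable.tsum fun j =>
          Measurable.ite (hms j) measurable_const measurable_const),
          lintegral_tsum fun j =>
            (Measurable.ite (hms j) measurable_const measurable_const).aemeasurable]
        congr 1
        refine tsum_congr fun j => ?_
        rw [← mul_assoc, ← sq, ← setLIntegral_const, ← lintegral_indicator (hms j)]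
        refine lintegral_congr fun x => ?_
        simp [Set.indicator]
    _ ≤ 4 * ∑' j : ℤ, (2 : ℝ≥0∞) ^ j *
          (128 * ∫⁻ x, if (2 : ℝ≥0∞) ^ j < 2 * g x then g x else 0) := by
        gcongr 4 * ?_
        refine ENNReal.tsum_le_tsum fun j => ?_
        gcongr 2 ^ j * ?_
        exact hlevel j
    _ = 512 * ∫⁻ x, ∑' j : ℤ, g x * (if (2 : ℝ≥0∞) ^ j < 2 * g x then (2 : ℝ≥0∞) ^ j else 0) := by
        have hms : ∀ j : ℤ, MeasurableSet {x | (2 : ℝ≥0∞) ^ j < 2 * g x} :=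
          fun j => measurableSet_lt measurable_const (hg.const_mul _)
        have hm : ∀ j : ℤ, Measurable fun x =>
            g x * (if (2 : ℝ≥0∞) ^ j < 2 * g x then (2 : ℝ≥0∞) ^ j else 0) :=
          fun j => hg.mul (Measurable.ite (hms j) measurable_const measurable_const)
        rw [lintegral_tsum fun j => (hm j).aemeasurable, ← ENNReal.tsum_mul_left,
          ← ENNReal.tsum_mul_left]
        refine tsum_congr fun j => ?_
        have : ∀ x, g x * (if (2 : ℝ≥0∞) ^ j < 2 * g x then (2 : ℝ≥0∞) ^ j else 0)
            = 2 ^ j * (if (2 : ℝ≥0∞) ^ j < 2 * g x then g x else 0) := by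
          intro x
          split_ifs <;> simp [mul_comm]
        simp only [this]
        rw [lintegral_const_mul _ (Measurable.ite (hms j) hg measurable_const)]
        ring
    _ ≤ 512 * ∫⁻ x, g x * (2 * (2 * g x)) := by
        gcongr with x
        rw [ENNReal.tsum_mul_left]
        gcongr
        exact tsum_two_zpow_lt_le _
    _ = 2048 * ∫⁻ x, g x ^ 2 := by
        have : ∀ x, g x * (2 * (2 * g x)) = 4 * g x ^ 2 := fun x => by ring
        simp only [this]
        rw [lintegral_const_mul _ (hg.pow_const 2), ← mul_assoc]
        norm_num

/-! ### The Coulomb energy and ball averages. -/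

/-- Averaging over balls is a symmetric operation. -/
theorem lintegral_mul_avgBy_ballMeasure (r : ℝ) {g h : R3 → ℝ≥0∞} (hg : Measurable g)
    (hh : Measurable h) :
    ∫⁻ x, h x * avgBy (ballMeasure r) g x = ∫⁻ x, g x * avgBy (ballMeasure r) h x := by
  have key : ∀ g h : R3 → ℝ≥0∞, Measurable g → Measurable h → ∀ x,
      h x * avgBy (ballMeasure r) g x = ∫⁻ y, (volume (Metric.ball (0 : R3) r))⁻¹ *
        (if dist x y < r then h x * g y else 0) := by
    intro g h hg hh x
    rw [avgBy_ballMeasure, Measure.addHaar_ball_center, lintegral_const_mul,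
      ← lintegral_indicator measurableSet_ball, mul_left_comm, ← lintegral_const_mul]
    · congr 1
      refine lintegral_congr fun y => ?_
      by_cases hy : dist x y < r
      · rw [if_pos hy, Set.indicator_of_mem (by rwa [Metric.mem_ball, dist_comm])]
      · rw [if_neg hy, Set.indicator_of_notMem (by rwa [Metric.mem_ball, dist_comm]), mul_zero]
    · exact hg.indicator measurableSet_ball
    · exact Measurable.ite (measurableSet_lt (by fun_prop) measurable_const) (by fun_prop)
        measurable_const
  simp only [key g h hg hh, key h g hh hg]
  rw [lintegral_lintegral_swap]
  · simp only [dist_comm, mul_comm (h _)]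
  · refine Measurable.aemeasurable ?_
    refine Measurable.const_mul (Measurable.ite ?_ (by fun_prop) measurable_const) _
    exact measurableSet_lt (by fun_prop) measurable_const

/-- A ball of radius `r` centred in `B(x, r)` lies in `B(x, 2r)`, so every inner average has the
same bound. -/
theorem avgBy_avgBy_ballMeasure_le {r : ℝ} (hr : 0 < r) (f : R3 → ℝ≥0∞) (x : R3) :
    avgBy (ballMeasure r) (avgBy (ballMeasure r) f) x
      ≤ (volume (Metric.ball (0 : R3) r))⁻¹ * ∫⁻ y in Metric.ball x (2 * r), f y := by
  have := isProbabilityMeasure_ballMeasure hr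
  rw [avgBy_ballMeasure]
  calc (volume (Metric.ball x r))⁻¹ * ∫⁻ y in Metric.ball x r, avgBy (ballMeasure r) f y
      ≤ (volume (Metric.ball x r))⁻¹ * ∫⁻ _ in Metric.ball x r,
          ((volume (Metric.ball (0 : R3) r))⁻¹ * ∫⁻ y in Metric.ball x (2 * r), f y) := by
        gcongr 1
        refine setLIntegral_mono' measurableSet_ball fun y hy => ?_
        rw [avgBy_ballMeasure, Measure.addHaar_ball_center]
        gcongr 1
        refine lintegral_mono_set (Metric.ball_subset_ball' ?_)
        rw [Metric.mem_ball] at hy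
        linarith
    _ = _ := by
        rw [setLIntegral_const, mul_comm _ (volume _), ← mul_assoc, ENNReal.inv_mul_cancel
          (volume_ball_ne_zero _ hr) (volume_ball_ne_top _ _), one_mul]

/-- Replacing `k` by `-k` turns this into the sum of the dyadic numbers below `2/d`. It bounds a
dyadic superposition of ball kernels by the Coulomb kernel. -/
theorem tsum_inv_two_zpow_le (d : ℝ≥0∞) :
    ∑' k : ℤ, (if d < 2 * 2 ^ k then ((2 : ℝ≥0∞) ^ k)⁻¹ else 0) ≤ 4 * d⁻¹ := by
  rw [← (Equiv.neg ℤ).tsum_eq]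
  calc _ ≤ ∑' k : ℤ, (if (2 : ℝ≥0∞) ^ k < 2 * d⁻¹ then (2 : ℝ≥0∞) ^ k else 0) := by
        refine ENNReal.tsum_le_tsum fun k => ?_
        simp only [Equiv.neg_apply, ENNReal.zpow_neg, inv_inv]
        split_ifs with h1 h2
        · exact le_rfl
        · refine absurd ?_ h2
          rw [← ENNReal.inv_lt_inv, ENNReal.mul_inv (by simp) (by simp), inv_inv]
          rw [mul_comm, ← div_eq_mul_inv]
          rw [ENNReal.div_lt_iff (by simp) (by simp)]
          rwa [mul_comm]
        · exact zero_le
        · exact le_rfl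
    _ ≤ 2 * (2 * d⁻¹) := tsum_two_zpow_lt_le _
    _ = 4 * d⁻¹ := by rw [← mul_assoc]; norm_num

/-- The Coulomb energy dominates the dyadic sum of the energies of the ball averages. -/
theorem tsum_lintegral_avgBy_sq_le {f : R3 → ℝ≥0∞} (hf : Measurable f) :
    ∑' k : ℤ, ((2 : ℝ≥0∞) ^ k) ^ 2 * ∫⁻ x, avgBy (ballMeasure ((2 : ℝ) ^ k)) f x ^ 2
      ≤ 4 * (volume (Metric.ball (0 : R3) 1))⁻¹ * ∫⁻ x, ∫⁻ y, f x * f y * (edist x y)⁻¹ := by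
  set v := (volume (Metric.ball (0 : R3) 1))⁻¹
  -- By symmetry the square integral equals `∫ f · A_k A_k f`, and the kernel of `A_k A_k` is at
  -- most `1/|B(0, 2^k)|` on `|x - y| < 2^(k+1)`.
  have hterm : ∀ k : ℤ,
      ((2 : ℝ≥0∞) ^ k) ^ 2 * ∫⁻ x, avgBy (ballMeasure ((2 : ℝ) ^ k)) f x ^ 2
      ≤ ∫⁻ x, ∫⁻ y, v * (f x * f y) *
        (if edist x y < 2 * 2 ^ k then ((2 : ℝ≥0∞) ^ k)⁻¹ else 0) := by
    intro k
    have hk : (0 : ℝ) < 2 ^ k := by positivity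
    have hA := measurable_avgBy (ballMeasure ((2 : ℝ) ^ k)) hf
    -- Dimension three enters here: `2^(2k) · 2^(-3k) = 2^(-k)`, the size of the Coulomb kernel at
    -- distance `2^k`.
    have hvol : ((2 : ℝ≥0∞) ^ k) ^ 2 * (volume (Metric.ball (0 : R3) (2 ^ k)))⁻¹
        = v * (2 ^ k)⁻¹ := by
      rw [← mul_one ((2 : ℝ) ^ k), volume_ball_mul 0 0 hk.le zero_le_one, ENNReal.mul_inv
        (Or.inr (volume_ball_ne_top _ _)) (Or.inr (volume_ball_ne_zero _ one_pos)),
        ENNReal.ofReal_pow hk.le, ofReal_two_zpow, ← mul_assoc, mul_comm]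
      congr 1
      rw [ENNReal.inv_pow, pow_succ (((2 : ℝ≥0∞) ^ k)⁻¹) 2, ← mul_assoc, ← mul_pow,
        ENNReal.mul_inv_cancel (two_zpow_ne_zero k) (two_zpow_ne_top k), one_pow, one_mul]
    simp only [sq (avgBy _ _ _)]
    have hAA : Measurable fun x => f x * avgBy (ballMeasure ((2 : ℝ) ^ k))
        (avgBy (ballMeasure ((2 : ℝ) ^ k)) f) x := hf.mul (measurable_avgBy _ hA)
    rw [lintegral_mul_avgBy_ballMeasure _ hf hA, ← lintegral_const_mul _ hAA]
    refine lintegral_mono fun x => ?_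
    calc ((2 : ℝ≥0∞) ^ k) ^ 2 * (f x * avgBy (ballMeasure (2 ^ k))
          (avgBy (ballMeasure (2 ^ k)) f) x)
        ≤ ((2 : ℝ≥0∞) ^ k) ^ 2 * (f x * ((volume (Metric.ball (0 : R3) (2 ^ k)))⁻¹ *
            ∫⁻ y in Metric.ball x (2 * 2 ^ k), f y)) := by
          refine mul_le_mul_right (mul_le_mul_right ?_ _) _
          exact avgBy_avgBy_ballMeasure_le hk f x
      _ = v * f x * (2 ^ k)⁻¹ * ∫⁻ y in Metric.ball x (2 * 2 ^ k), f y := by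
          rw [mul_right_comm v, ← hvol]; ring
      _ = _ := by
          rw [← lintegral_indicator measurableSet_ball,
            ← lintegral_const_mul _ (hf.indicator measurableSet_ball)]
          refine lintegral_congr fun y => ?_
          have hiff : y ∈ Metric.ball x (2 * 2 ^ k) ↔ edist x y < 2 * 2 ^ k := by
            have h2 : (2 : ℝ≥0∞) * 2 ^ k = ENNReal.ofReal (2 * 2 ^ k) := by
              rw [ENNReal.ofReal_mul (by norm_num), ofReal_two_zpow, ENNReal.ofReal_ofNat]
            rw [Metric.mem_ball, edist_comm, h2, edist_dist,
              ENNReal.ofReal_lt_ofReal_iff (by positivity)]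
          by_cases hy : y ∈ Metric.ball x (2 * 2 ^ k)
          · rw [Set.indicator_of_mem hy, if_pos (hiff.mp hy)]; ring
          · rw [Set.indicator_of_notMem hy, if_neg (fun h => hy (hiff.mpr h))]; simp
  have hm : ∀ k : ℤ, Measurable fun p : R3 × R3 => v * (f p.1 * f p.2) *
        (if edist p.1 p.2 < 2 * 2 ^ k then ((2 : ℝ≥0∞) ^ k)⁻¹ else 0) := fun k =>
    Measurable.mul (by fun_prop) (Measurable.ite
      (measurableSet_lt (by fun_prop) measurable_const) measurable_const measurable_const)
  calc _ ≤ ∑' k : ℤ, ∫⁻ x, ∫⁻ y, v * (f x * f y) *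
        (if edist x y < 2 * 2 ^ k then ((2 : ℝ≥0∞) ^ k)⁻¹ else 0) :=
        ENNReal.tsum_le_tsum hterm
    _ = ∫⁻ x, ∫⁻ y, ∑' k : ℤ, v * (f x * f y) *
        (if edist x y < 2 * 2 ^ k then ((2 : ℝ≥0∞) ^ k)⁻¹ else 0) := by
        rw [← lintegral_tsum fun k => ((hm k).lintegral_prod_right').aemeasurable]
        refine lintegral_congr fun x => ?_
        exact (lintegral_tsum fun k => ((hm k).comp measurable_prodMk_left).aemeasurable).symm
    _ ≤ ∫⁻ x, ∫⁻ y, 4 * v * (f x * f y * (edist x y)⁻¹) := by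
        refine lintegral_mono fun x => lintegral_mono fun y => ?_
        simp only
        rw [ENNReal.tsum_mul_left]
        refine (mul_le_mul_right (tsum_inv_two_zpow_le (edist x y)) _).trans (le_of_eq ?_)
        ring
    _ = _ := by
        have hm2 : Measurable fun p : R3 × R3 => f p.1 * f p.2 * (edist p.1 p.2)⁻¹ := by
          fun_prop
        rw [← lintegral_const_mul _ hm2.lintegral_prod_right']
        refine lintegral_congr fun x => ?_
        exact lintegral_const_mul _ (hm2.comp measurable_prodMk_left)

/-- The two integrands can differ only at `y = x`, where real division by zero gives `0` but `(edist
x y)⁻¹ = ⊤`; this is a null set for each `x`. -/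
theorem coulombEnergy_eq_lintegral (u : R3 → ℝ) :
    coulombEnergy u = ∫⁻ x, ∫⁻ y, ‖u x‖ₑ ^ 2 * ‖u y‖ₑ ^ 2 * (edist x y)⁻¹ := by
  unfold coulombEnergy
  refine lintegral_congr fun x => lintegral_congr_ae ?_
  have : ∀ᵐ y : R3, y ≠ x := by simp [ae_iff, measure_singleton]
  filter_upwards [this] with y hy
  have hpos : 0 < ‖x - y‖ := norm_pos_iff.mpr (sub_ne_zero.mpr (Ne.symm hy))
  rw [ENNReal.ofReal_div_of_pos hpos, ENNReal.ofReal_mul (by positivity), edist_dist,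
    dist_eq_norm, div_eq_mul_inv]
  congr 2
  · rw [Real.enorm_eq_ofReal_abs, ← ENNReal.ofReal_pow (abs_nonneg _), sq_abs]
  · rw [Real.enorm_eq_ofReal_abs, ← ENNReal.ofReal_pow (abs_nonneg _), sq_abs]

/-! ### Ray integrals for `C¹` functions. -/

theorem enorm_clm_le_of_forall {L : R3 →L[ℝ] ℝ} {C : ℝ≥0∞} (h : ∀ v, ‖L v‖ₑ ≤ C * ‖v‖ₑ) :
    ‖L‖ₑ ≤ C := by
  rcases eq_or_ne C ⊤ with rfl | hC
  · exact le_top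
  lift C to NNReal using hC
  have : ‖L‖₊ ≤ C := L.opNNNorm_le_bound C fun v => by
    have := h v
    simp only [enorm_eq_nnnorm] at this
    exact_mod_cast this
  rw [enorm_eq_nnnorm]
  exact_mod_cast this

/-- The dilation by `t` carries the uniform measure on the ball of radius `r` to that of radius `t *
r`. -/
theorem lintegral_ballMeasure_comp_smul {t r : ℝ} (ht : 0 < t) (hr : 0 < r) {g : R3 → ℝ≥0∞}
    (hg : Measurable g) (x : R3) :
    ∫⁻ z, g (x + t • z) ∂ballMeasure r = avgBy (ballMeasure (t * r)) g x := by
  unfold avgBy ballMeasure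
  rw [lintegral_smul_measure, lintegral_smul_measure, smul_eq_mul, smul_eq_mul,
    volume_ball_mul 0 0 ht.le hr.le, ← lintegral_indicator measurableSet_ball,
    ← lintegral_indicator measurableSet_ball]
  have h1 : ∀ z : R3, (Metric.ball (0 : R3) r).indicator (fun z => g (x + t • z)) z
      = (Metric.ball (0 : R3) (t * r)).indicator (fun z => g (x + z)) (t • z) := by
    intro z
    simp only [Set.indicator, mem_ball_zero_iff, norm_smul, Real.norm_of_nonneg ht.le,
      mul_lt_mul_iff_right₀ ht]
  have hm : Measurable ((Metric.ball (0 : R3) (t * r)).indicator (fun z => g (x + z))) :=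
    Measurable.indicator (by fun_prop) measurableSet_ball
  simp only [h1]
  rw [← lintegral_map (f := (Metric.ball (0 : R3) (t * r)).indicator (fun z => g (x + z)))
      (g := fun z : R3 => t • z) hm (by fun_prop),
    Measure.map_addHaar_smul _ ht.ne', lintegral_smul_measure, finrank_euclideanSpace_fin,
    abs_of_pos (by positivity), smul_eq_mul, ← mul_assoc, ENNReal.mul_inv
      (Or.inr (volume_ball_ne_top _ _)) (Or.inr (volume_ball_ne_zero _ hr)),
    ENNReal.ofReal_inv_of_pos (by positivity), mul_comm (ENNReal.ofReal (t ^ 3))⁻¹]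

/-- The fundamental theorem of calculus on the segment from `x` to `x + z`. -/
theorem enorm_le_enorm_add_lintegral_fderiv {w : R3 → ℝ} (hw : ContDiff ℝ 1 w) (x z : R3) :
    ‖w x‖ₑ ≤ ‖w (x + z)‖ₑ
      + ‖z‖ₑ * ∫⁻ t in Set.Ioc (0 : ℝ) 1, ‖fderiv ℝ w (x + t • z)‖ₑ := by
  have hc : Continuous (fderiv ℝ w) := hw.continuous_fderiv one_ne_zero
  have hd : ∀ t ∈ Set.uIcc (0 : ℝ) 1,
      HasDerivAt (fun t : ℝ => w (x + t • z)) (fderiv ℝ w (x + t • z) z) t := by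
    intro t _
    have h1 : HasDerivAt (fun t : ℝ => x + t • z) z t := by
      simpa using ((hasDerivAt_id t).smul_const z).const_add x
    exact ((hw.differentiable one_ne_zero _).hasFDerivAt).comp_hasDerivAt t h1
  have hInt := intervalIntegral.integral_eq_sub_of_hasDerivAt hd
    (Continuous.intervalIntegrable (by fun_prop) _ _)
  simp only [one_smul, zero_smul, add_zero] at hInt
  have hb : ‖w (x + z) - w x‖ₑ
      ≤ ‖z‖ₑ * ∫⁻ t in Set.Ioc (0 : ℝ) 1, ‖fderiv ℝ w (x + t • z)‖ₑ := by
    rw [← hInt, intervalIntegral.integral_of_le zero_le_one,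
      ← lintegral_const_mul _ (by fun_prop)]
    refine (enorm_integral_le_lintegral_enorm _).trans (lintegral_mono fun t => ?_)
    rw [mul_comm]
    exact (fderiv ℝ w (x + t • z)).le_opENorm z
  calc ‖w x‖ₑ = ‖w (x + z) - (w (x + z) - w x)‖ₑ := by rw [sub_sub_cancel]
    _ ≤ ‖w (x + z)‖ₑ + ‖w (x + z) - w x‖ₑ := enorm_sub_le
    _ ≤ _ := by gcongr

/-- A `C¹` function is controlled by its ball averages and those of its derivative. -/
theorem enorm_le_avgBy_add_lintegral {w : R3 → ℝ} (hw : ContDiff ℝ 1 w) {r : ℝ} (hr : 0 < r)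
    (x : R3) :
    ‖w x‖ₑ ≤ avgBy (ballMeasure r) (fun y => ‖w y‖ₑ) x + ENNReal.ofReal r *
      ∫⁻ t in Set.Ioc (0 : ℝ) 1, avgBy (ballMeasure (t * r)) (fun y => ‖fderiv ℝ w y‖ₑ) x := by
  have := isProbabilityMeasure_ballMeasure hr
  have hc : Continuous (fderiv ℝ w) := hw.continuous_fderiv one_ne_zero
  have hcw : Continuous w := hw.continuous
  have hae : ∀ᵐ z ∂ballMeasure r, ‖z‖ₑ ≤ ENNReal.ofReal r := by
    unfold ballMeasure
    refine Measure.ae_smul_measure ?_ _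
    filter_upwards [ae_restrict_mem measurableSet_ball] with z hz
    rw [mem_ball_zero_iff] at hz
    rw [← ofReal_norm]
    exact ENNReal.ofReal_le_ofReal hz.le
  have hm : Measurable (Function.uncurry fun (z : R3) (t : ℝ) => ‖fderiv ℝ w (x + t • z)‖ₑ) := by
    unfold Function.uncurry
    have : Continuous fun p : R3 × ℝ => fderiv ℝ w (x + p.2 • p.1) := by fun_prop
    exact this.enorm.measurable
  calc ‖w x‖ₑ = ∫⁻ _, ‖w x‖ₑ ∂ballMeasure r := by simp
    _ ≤ ∫⁻ z, (‖w (x + z)‖ₑ + ENNReal.ofReal r *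
          ∫⁻ t in Set.Ioc (0 : ℝ) 1, ‖fderiv ℝ w (x + t • z)‖ₑ) ∂ballMeasure r := by
        refine lintegral_mono_ae ?_
        filter_upwards [hae] with z hz
        refine (enorm_le_enorm_add_lintegral_fderiv hw x z).trans ?_
        gcongr
    _ = avgBy (ballMeasure r) (fun y => ‖w y‖ₑ) x + ENNReal.ofReal r *
          ∫⁻ z, (∫⁻ t in Set.Ioc (0 : ℝ) 1, ‖fderiv ℝ w (x + t • z)‖ₑ) ∂ballMeasure r := by
        have hm' : Measurable fun z => ∫⁻ t in Set.Ioc (0 : ℝ) 1, ‖fderiv ℝ w (x + t • z)‖ₑ :=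
          hm.lintegral_prod_right'
        rw [lintegral_add_left (by fun_prop : Continuous fun z => ‖w (x + z)‖ₑ).measurable,
          lintegral_const_mul _ hm']
        rfl
    _ = _ := by
        -- For fixed `t`, averaging over `z` in the ball of radius `r` is averaging the derivative
        -- over the ball of radius `t * r`.
        rw [lintegral_lintegral_swap hm.aemeasurable]
        congr 2
        refine setLIntegral_congr_fun measurableSet_Ioc fun t ht => ?_
        exact lintegral_ballMeasure_comp_smul ht.1 hr hc.enorm.measurable x

/-! ### Mollification and weakly differentiable functions. -/

/-- The mollifying measure with density the normalized bump function `φ`. -/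
noncomputable def mollifier (φ : ContDiffBump (0 : R3)) : Measure R3 :=
  volume.withDensity fun z => ENNReal.ofReal (φ.normed volume z)

instance sFinite_mollifier (φ : ContDiffBump (0 : R3)) : SFinite (mollifier φ) := by
  unfold mollifier; infer_instance

/-- Substitute `y = x + z`; evenness of the bump gives the convolution form. -/
theorem avgBy_mollifier (φ : ContDiffBump (0 : R3)) {g : R3 → ℝ≥0∞} (hg : Measurable g) (x : R3) :
    avgBy (mollifier φ) g x = ∫⁻ y, ENNReal.ofReal (φ.normed volume (x - y)) * g y := by
  have hρ : Continuous (φ.normed (volume : Measure R3)) := φ.continuous_normed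
  unfold avgBy mollifier
  rw [lintegral_withDensity_eq_lintegral_mul _ (by fun_prop) (by fun_prop),
    ← lintegral_add_left_eq_self (fun y => ENNReal.ofReal (φ.normed volume (x - y)) * g y) x]
  refine lintegral_congr fun z => ?_
  simp [φ.normed_neg]

theorem enorm_convolution_le_avgBy (φ : ContDiffBump (0 : R3)) {u : R3 → ℝ} (hu : Measurable u)
    (x : R3) :
    ‖convolution (φ.normed volume) u (ContinuousLinearMap.lsmul ℝ ℝ) volume x‖ₑ
      ≤ avgBy (mollifier φ) (fun y => ‖u y‖ₑ) x := by
  rw [convolution_lsmul_swap, avgBy_mollifier _ hu.enorm]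
  refine (enorm_integral_le_lintegral_enorm _).trans (lintegral_mono fun y => ?_)
  rw [enorm_smul, Real.enorm_of_nonneg (φ.nonneg_normed _)]

theorem avgBy_mollifier_ofReal (φ : ContDiffBump (0 : R3)) {H : R3 → ℝ} (hm : Measurable H)
    (hH : LocallyIntegrable H volume) (h0 : ∀ x, 0 ≤ H x) (x : R3) :
    avgBy (mollifier φ) (fun y => ENNReal.ofReal (H y)) x = ENNReal.ofReal
      (convolution (φ.normed volume) H (ContinuousLinearMap.lsmul ℝ ℝ) volume x) := by
  have hex : Integrable fun y => φ.normed volume (x - y) • H y :=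
    ((φ.hasCompactSupport_normed (μ := volume)).convolutionExists_left
      (ContinuousLinearMap.lsmul ℝ ℝ) φ.continuous_normed hH x).integrable_swap
  rw [convolution_lsmul_swap, avgBy_mollifier _ hm.ennreal_ofReal,
    ofReal_integral_eq_lintegral_ofReal hex
      (Filter.Eventually.of_forall fun y => mul_nonneg (φ.nonneg_normed _) (h0 y))]
  refine lintegral_congr fun y => ?_
  rw [smul_eq_mul, ENNReal.ofReal_mul (φ.nonneg_normed _)]

/-- The derivative falls on the mollifier, and `y ↦ ρ(x - y)` is a test function, so the weak
gradient identity moves it to `G`. -/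
theorem enorm_fderiv_convolution_le_avgBy (φ : ContDiffBump (0 : R3)) {u : R3 → ℝ} {G : R3 → R3}
    (hG : Measurable G) (h : HasWeakGradient u G) (x : R3) :
    ‖fderiv ℝ (convolution (φ.normed volume) u (ContinuousLinearMap.lsmul ℝ ℝ) volume) x‖ₑ
      ≤ avgBy (mollifier φ) (fun y => ‖G y‖ₑ) x := by
  have hρ : ContDiff ℝ ∞ (φ.normed (volume : Measure R3)) := φ.contDiff_normed
  have hcs := φ.hasCompactSupport_normed (μ := volume)
  have hD := hcs.hasFDerivAt_convolution_left (ContinuousLinearMap.lsmul ℝ ℝ)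
    (hρ.of_le (by exact_mod_cast le_top)) h.locallyIntegrable x
  have hex := (hcs.fderiv (𝕜 := ℝ)).convolutionExists_left
    ((ContinuousLinearMap.lsmul ℝ ℝ).precompL R3) (hρ.continuous_fderiv (by simp))
    h.locallyIntegrable x
  rw [hD.fderiv]
  refine enorm_clm_le_of_forall fun v => ?_
  set ψ : R3 → ℝ := fun y => φ.normed volume (x - y)
  have hψ : ContDiff ℝ ∞ ψ := hρ.comp (contDiff_const.sub contDiff_id)
  have hψc : HasCompactSupport ψ := hcs.comp_homeomorph (Homeomorph.subLeft x)
  have hfd : ∀ y, fderiv ℝ ψ y (-v) = fderiv ℝ (φ.normed volume) (x - y) v := by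
    intro y
    have h1 : HasFDerivAt ψ ((fderiv ℝ (φ.normed volume) (x - y)).comp
        (-ContinuousLinearMap.id ℝ R3)) y :=
      ((hρ.differentiable (by simp) _).hasFDerivAt).comp y ((hasFDerivAt_id y).const_sub x)
    rw [h1.fderiv]
    simp
  have hval : convolution (fderiv ℝ (φ.normed volume)) u
      ((ContinuousLinearMap.lsmul ℝ ℝ).precompL R3) volume x v
      = ∫ y, inner ℝ (G y) v * ψ y := by
    rw [convolution_eq_swap, ContinuousLinearMap.integral_apply hex.integrable_swap]
    -- The direction `-v` compensates the sign from the reflection `y ↦ x - y`.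
    have h1 := h.integral_eq ψ hψ hψc (-v)
    simp only [hfd, inner_neg_right, neg_mul, integral_neg, neg_neg] at h1
    rw [← h1]
    refine integral_congr_ae (Filter.Eventually.of_forall fun y => ?_)
    simp [ContinuousLinearMap.precompL, mul_comm]
  rw [hval, avgBy_mollifier _ hG.enorm, ← lintegral_mul_const _ ?_]
  · refine (enorm_integral_le_lintegral_enorm _).trans (lintegral_mono fun y => ?_)
    rw [enorm_mul, Real.enorm_of_nonneg (φ.nonneg_normed _), mul_comm, mul_assoc]
    gcongr
    simp only [← ofReal_norm]
    rw [← ENNReal.ofReal_mul (norm_nonneg _)]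
    exact ENNReal.ofReal_le_ofReal (norm_inner_le_norm _ _)
  · exact (hψ.continuous.measurable.ennreal_ofReal).mul hG.enorm

/-- Membership in `Lⁿ` with `n ≥ 1` implies local integrability, which the mollification of the
majorant requires. -/
theorem locallyIntegrable_toReal_of_lintegral_pow {F : R3 → ℝ≥0∞} (hF : Measurable F) {n : ℕ}
    (hn : 1 ≤ n) (h : ∫⁻ x, F x ^ n ≠ ⊤) :
    LocallyIntegrable (fun x => (F x).toReal) volume := by
  have hmem : MemLp (fun x => (F x).toReal) n volume := by
    refine ⟨hF.ennreal_toReal.aestronglyMeasurable, ?_⟩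
    rw [eLpNorm_lt_top_iff_lintegral_rpow_enorm_lt_top (by simpa using (by omega : n ≠ 0))
      (ENNReal.natCast_ne_top n)]
    refine lt_of_le_of_lt (lintegral_mono fun x => ?_) h.lt_top
    rw [ENNReal.toReal_natCast, ENNReal.rpow_natCast]
    gcongr
    rw [Real.enorm_of_nonneg ENNReal.toReal_nonneg]
    exact ENNReal.ofReal_toReal_le
  exact hmem.locallyIntegrable (by exact_mod_cast hn)

theorem ae_lt_top_of_lintegral_pow {F : R3 → ℝ≥0∞} (hF : Measurable F) {n : ℕ}
    (hn : n ≠ 0) (h : ∫⁻ x, F x ^ n ≠ ⊤) : ∀ᵐ x, F x < ⊤ := by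
  filter_upwards [ae_lt_top (hF.pow_const n) h] with x hx
  by_contra hx'
  rw [not_lt, top_le_iff] at hx'
  rw [hx', ENNReal.top_pow hn] at hx
  exact lt_irrefl _ hx

/-- A weakly differentiable function is controlled by its ball averages and the maximal function
of its gradient. -/
theorem HasWeakGradient.ae_enorm_le {u : R3 → ℝ} {G : R3 → R3} (hu : Measurable u)
    (hG : Measurable G) (h : HasWeakGradient u G) {r : ℝ} (hr : 0 < r)
    (h4 : ∫⁻ x, avgBy (ballMeasure r) (fun y => ‖u y‖ₑ) x ^ 4 ≠ ⊤)
    (h2 : ∫⁻ x, dyadicMaximal (fun y => ‖G y‖ₑ) x ^ 2 ≠ ⊤) :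
    ∀ᵐ x, ‖u x‖ₑ ≤ avgBy (ballMeasure r) (fun y => ‖u y‖ₑ) x
      + ENNReal.ofReal r * (8 * dyadicMaximal (fun y => ‖G y‖ₑ) x) := by
  set A := avgBy (ballMeasure r) (fun y => ‖u y‖ₑ)
  set N := dyadicMaximal (fun y => ‖G y‖ₑ)
  have hA : Measurable A := measurable_avgBy _ hu.enorm
  have hN : Measurable N := measurable_dyadicMaximal hG.enorm
  -- A real-valued version of the majorant, so that its mollifications converge to it almost
  -- everywhere.
  set H : R3 → ℝ := fun x => (A x).toReal + (r * 8) * (N x).toReal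
  have hHm : Measurable H := by fun_prop
  have hH0 : ∀ x, 0 ≤ H x := fun x => by positivity
  have hHint : LocallyIntegrable H volume :=
    (locallyIntegrable_toReal_of_lintegral_pow hA (by norm_num) h4).add
      ((locallyIntegrable_toReal_of_lintegral_pow hN (by norm_num) h2).smul (r * 8))
  have hFH : ∀ᵐ x, A x + ENNReal.ofReal r * (8 * N x) = ENNReal.ofReal (H x) := by
    filter_upwards [ae_lt_top_of_lintegral_pow hA (by norm_num) h4,
      ae_lt_top_of_lintegral_pow hN (by norm_num) h2] with x hx1 hx2
    simp only [H]
    rw [ENNReal.ofReal_add (by positivity) (by positivity), ENNReal.ofReal_mul (by positivity),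
      ENNReal.ofReal_mul hr.le, ENNReal.ofReal_toReal hx1.ne, ENNReal.ofReal_toReal hx2.ne,
      ENNReal.ofReal_ofNat, mul_assoc]
  -- The supports shrink to the origin with `rOut / rIn = 2` fixed; the bounded ratio is what almost
  -- everywhere convergence needs.
  let φ : ℕ → ContDiffBump (0 : R3) := fun n =>
    ⟨1 / ((n : ℝ) + 1), 2 * (1 / ((n : ℝ) + 1)), by positivity, by
      have : (0 : ℝ) < 1 / ((n : ℝ) + 1) := by positivity
      linarith⟩
  have hφ : Filter.Tendsto (fun n => (φ n).rOut) Filter.atTop (nhds 0) := by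
    simpa [φ] using (tendsto_one_div_add_atTop_nhds_zero_nat (𝕜 := ℝ)).const_mul 2
  have hφ' : ∀ᶠ n in Filter.atTop, (φ n).rOut ≤ 2 * (φ n).rIn :=
    Filter.Eventually.of_forall fun n => le_rfl
  -- Apply the `C¹` estimate to the mollified `u` and commute ball averages with the mollifier: the
  -- majorant of the mollification is the mollified majorant.
  have hmoll : ∀ n x, ‖convolution ((φ n).normed volume) u (ContinuousLinearMap.lsmul ℝ ℝ)
      volume x‖ₑ ≤ ENNReal.ofReal (convolution ((φ n).normed volume) H
        (ContinuousLinearMap.lsmul ℝ ℝ) volume x) := by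
    intro n x
    set w := convolution ((φ n).normed volume) u (ContinuousLinearMap.lsmul ℝ ℝ) volume
    have hw : ContDiff ℝ 1 w := (φ n).hasCompactSupport_normed.contDiff_convolution_left
      (n := 1) _ (φ n).contDiff_normed h.locallyIntegrable
    have hfd : ∀ t ∈ Set.Ioc (0 : ℝ) 1,
        avgBy (ballMeasure (t * r)) (fun y => ‖fderiv ℝ w y‖ₑ) x
          ≤ avgBy (mollifier (φ n)) (fun y => 8 * N y) x := by
      intro t ht
      refine (avgBy_mono _ (enorm_fderiv_convolution_le_avgBy (φ n) hG h) x).trans ?_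
      rw [avgBy_comm _ _ hG.enorm]
      exact avgBy_mono _ (avgBy_ballMeasure_le_dyadicMaximal (mul_pos ht.1 hr) _) x
    calc ‖w x‖ₑ ≤ avgBy (ballMeasure r) (fun y => ‖w y‖ₑ) x + ENNReal.ofReal r *
          ∫⁻ t in Set.Ioc (0 : ℝ) 1, avgBy (ballMeasure (t * r))
            (fun y => ‖fderiv ℝ w y‖ₑ) x := enorm_le_avgBy_add_lintegral hw hr x
      _ ≤ avgBy (mollifier (φ n)) A x
          + ENNReal.ofReal r * avgBy (mollifier (φ n)) (fun y => 8 * N y) x := by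
          gcongr
          · rw [avgBy_comm _ _ hu.enorm]
            exact avgBy_mono _ (enorm_convolution_le_avgBy (φ n) hu) x
          · refine (setLIntegral_mono' measurableSet_Ioc hfd).trans ?_
            simp
      _ = avgBy (mollifier (φ n)) (fun y => A y + ENNReal.ofReal r * (8 * N y)) x := by
          unfold avgBy
          rw [lintegral_add_left (by fun_prop), ← lintegral_const_mul _ (by fun_prop)]
      _ = avgBy (mollifier (φ n)) (fun y => ENNReal.ofReal (H y)) x := by
          rw [avgBy_mollifier _ (by fun_prop), avgBy_mollifier _ (by fun_prop)]
          refine lintegral_congr_ae ?_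
          filter_upwards [hFH] with y hy
          rw [hy]
      _ = _ := avgBy_mollifier_ofReal (φ n) hHm hHint hH0 x
  filter_upwards [hFH, ContDiffBump.ae_convolution_tendsto_right_of_locallyIntegrable hφ hφ'
    h.locallyIntegrable, ContDiffBump.ae_convolution_tendsto_right_of_locallyIntegrable hφ hφ'
    hHint] with x hx hux hHx
  rw [hx]
  exact le_of_tendsto_of_tendsto' hux.enorm (ENNReal.tendsto_ofReal hHx) fun n => hmoll n x

/-! ### Optimizing the scale, and the inclusions for `3 ≤ p < 6`. -/

/-- Balancing two bounds: at a scale `s` comparable to `a / N` the term `8 s N` is absorbed into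
`a`, so `b ≥ a / 2` and `s² a⁴ ≲ Q`. Eliminating `s` gives `a⁶ ≲ N² Q`. -/
theorem cube_le_of_forall_dyadic {a N Q : ℝ} (ha : 0 ≤ a) (hN : 0 ≤ N) (hQ : 0 ≤ Q)
    (h : ∀ k : ℤ, ∃ b : ℝ, a ≤ b + 2 ^ k * (8 * N) ∧ ((2 : ℝ) ^ k) ^ 2 * b ^ 4 ≤ Q) :
    a ^ 3 ≤ 64 * (N ^ 2 + Q) := by
  rcases ha.eq_or_lt with rfl | ha
  · norm_num
    positivity
  rcases hN.eq_or_lt with rfl | hN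
  -- If `N = 0` and `a > 0`, then `b ≥ a` at every scale, and letting the scale grow contradicts the
  -- bound by `Q`.
  · exfalso
    obtain ⟨n, hn⟩ := pow_unbounded_of_one_lt (Q / a ^ 4) (one_lt_two)
    obtain ⟨b, hb, hbQ⟩ := h n
    simp only [mul_zero, add_zero, zpow_natCast] at hb hbQ
    have h1 : (1 : ℝ) ≤ 2 ^ n := one_le_pow₀ (by norm_num)
    have h2 : a ^ 4 ≤ b ^ 4 := by gcongr
    rw [div_lt_iff₀ (by positivity)] at hn
    have h3 : (2 : ℝ) ^ n * a ^ 4 ≤ (2 ^ n) ^ 2 * b ^ 4 := by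
      gcongr
      nlinarith
    linarith
  -- This `k` gives both `8 s N ≤ a / 2` and `a < 32 s N`.
  obtain ⟨k, hk1, hk2⟩ := exists_mem_Ico_zpow (show 0 < a / (16 * N) by positivity)
    (one_lt_two (α := ℝ))
  obtain ⟨b, hb, hbQ⟩ := h k
  rw [zpow_add_one₀ (by norm_num)] at hk2
  have hs : (0 : ℝ) < 2 ^ k := by positivity
  set s : ℝ := 2 ^ k
  rw [le_div_iff₀ (by positivity)] at hk1
  rw [div_lt_iff₀ (by positivity)] at hk2
  have hb2 : a / 2 ≤ b := by nlinarith
  have h4 : s ^ 2 * (a / 2) ^ 4 ≤ Q := le_trans (by gcongr) hbQ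
  have h5 : a ^ 2 ≤ (32 * s * N) ^ 2 := by
    gcongr
    linarith
  have h6 : (a ^ 3) ^ 2 ≤ (64 * (N ^ 2 + Q)) ^ 2 := by
    calc (a ^ 3) ^ 2 = a ^ 2 * a ^ 4 := by ring
      _ ≤ (32 * s * N) ^ 2 * a ^ 4 := by gcongr
      _ = 16384 * N ^ 2 * (s ^ 2 * (a / 2) ^ 4) := by ring
      _ ≤ 16384 * N ^ 2 * Q := by gcongr
      _ ≤ (64 * (N ^ 2 + Q)) ^ 2 := by nlinarith [sq_nonneg (N ^ 2 - Q)]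
  exact (sq_le_sq₀ (by positivity) (by positivity)).mp h6

/-- `E(ℝ³) ⊆ L³(ℝ³)` for measurable representatives. -/
theorem HasWeakGradient.lintegral_enorm_cube_lt_top {u : R3 → ℝ} {G : R3 → R3} (hu : Measurable u)
    (hG : Measurable G) (h : HasWeakGradient u G) (hG2 : ∫⁻ x, ‖G x‖ₑ ^ 2 ≠ ⊤)
    (hE : coulombEnergy u ≠ ⊤) : ∫⁻ x, ‖u x‖ₑ ^ 3 < ⊤ := by
  set A : ℤ → R3 → ℝ≥0∞ := fun k => avgBy (ballMeasure ((2 : ℝ) ^ k)) (fun y => ‖u y‖ₑ)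
  set N := dyadicMaximal (fun y => ‖G y‖ₑ)
  set Q : R3 → ℝ≥0∞ := fun x => ∑' k : ℤ, ((2 : ℝ≥0∞) ^ k) ^ 2 * A k x ^ 4
  have hA : ∀ k, Measurable (A k) := fun k => measurable_avgBy _ hu.enorm
  have hN : Measurable N := measurable_dyadicMaximal hG.enorm
  have hQ : Measurable Q := Measurable.tsum fun k => ((hA k).pow_const 4).const_mul _
  have hN2 : ∫⁻ x, N x ^ 2 ≠ ⊤ := ne_top_of_le_ne_top (ENNReal.mul_ne_top (by norm_num) hG2)
    (lintegral_dyadicMaximal_sq_le hG.enorm)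
  have hQsum : ∫⁻ x, Q x = ∑' k : ℤ, ((2 : ℝ≥0∞) ^ k) ^ 2 * ∫⁻ x, A k x ^ 4 := by
    rw [lintegral_tsum fun k => (((hA k).pow_const 4).const_mul _).aemeasurable]
    exact tsum_congr fun k => lintegral_const_mul _ ((hA k).pow_const 4)
  have hQ1 : ∫⁻ x, Q x ≠ ⊤ := by
    rw [hQsum]
    refine ne_top_of_le_ne_top ?_ ((ENNReal.tsum_le_tsum fun k => ?_).trans
      (tsum_lintegral_avgBy_sq_le (hu.enorm.pow_const 2)))
    · rw [← coulombEnergy_eq_lintegral]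
      refine ENNReal.mul_ne_top (ENNReal.mul_ne_top (by norm_num) ?_) hE
      exact ENNReal.inv_ne_top.mpr (volume_ball_ne_zero _ one_pos)
    -- Cauchy–Schwarz in the form `(A_k|u|)⁴ ≤ (A_k u²)²`.
    · refine mul_le_mul_right (lintegral_mono fun x => ?_) _
      rw [show 4 = 2 * 2 from rfl, pow_mul]
      gcongr
      exact avgBy_sq_le _ hu.enorm x
  have hA4 : ∀ k, ∫⁻ x, A k x ^ 4 ≠ ⊤ := by
    intro k hk
    refine hQ1 ?_
    rw [hQsum]
    refine ENNReal.tsum_eq_top_of_eq_top ⟨k, ?_⟩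
    rw [hk]
    exact ENNReal.mul_top (pow_ne_zero _ (two_zpow_ne_zero k))
  -- Only countably many scales occur, so one null set serves them all and `k` may then depend on
  -- `x`.
  have hae : ∀ᵐ x, ∀ k : ℤ, ‖u x‖ₑ ≤ A k x + ENNReal.ofReal (2 ^ k) * (8 * N x) :=
    ae_all_iff.mpr fun k => h.ae_enorm_le hu hG (by positivity) (hA4 k) hN2
  have hpt : ∀ᵐ x, ‖u x‖ₑ ^ 3 ≤ 64 * (N x ^ 2 + Q x) := by
    filter_upwards [hae, ae_lt_top_of_lintegral_pow hN (by norm_num) hN2,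
      ae_lt_top hQ hQ1] with x hx hxN hxQ
    have hterm : ∀ k : ℤ, ((2 : ℝ≥0∞) ^ k) ^ 2 * A k x ^ 4 ≤ Q x := fun k =>
      ENNReal.le_tsum (f := fun k : ℤ => ((2 : ℝ≥0∞) ^ k) ^ 2 * A k x ^ 4) k
    have hAx : ∀ k, A k x ≠ ⊤ := by
      intro k hk
      have := hterm k
      rw [hk, ENNReal.top_pow (by norm_num),
        ENNReal.mul_top (pow_ne_zero _ (two_zpow_ne_zero k)), top_le_iff] at this
      exact hxQ.ne this
    have hreal := cube_le_of_forall_dyadic (norm_nonneg (u x)) (ENNReal.toReal_nonneg (a := N x))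
      (ENNReal.toReal_nonneg (a := Q x)) fun k => ⟨(A k x).toReal, ?_, ?_⟩
    · rw [← ofReal_norm, ← ENNReal.ofReal_pow (norm_nonneg _)]
      refine (ENNReal.ofReal_le_ofReal hreal).trans (le_of_eq ?_)
      rw [ENNReal.ofReal_mul (by norm_num), ENNReal.ofReal_add (by positivity) (by positivity),
        ENNReal.ofReal_pow (by positivity), ENNReal.ofReal_toReal hxN.ne,
        ENNReal.ofReal_toReal hxQ.ne, ENNReal.ofReal_ofNat]
    · have hfin : ENNReal.ofReal (2 ^ k) * (8 * N x) ≠ ⊤ :=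
        ENNReal.mul_ne_top ENNReal.ofReal_ne_top (ENNReal.mul_ne_top (by norm_num) hxN.ne)
      have := ENNReal.toReal_mono (ENNReal.add_ne_top.mpr ⟨hAx k, hfin⟩) (hx k)
      rw [ENNReal.toReal_add (hAx k) hfin, ENNReal.toReal_mul, ENNReal.toReal_mul,
        ENNReal.toReal_ofReal (by positivity), toReal_enorm] at this
      simpa using this
    · have := ENNReal.toReal_mono hxQ.ne (hterm k)
      rw [ENNReal.toReal_mul, ENNReal.toReal_pow, ENNReal.toReal_pow, ← ofReal_two_zpow,
        ENNReal.toReal_ofReal (by positivity)] at this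
      exact this
  refine (lintegral_mono_ae hpt).trans_lt ?_
  rw [lintegral_const_mul _ (by fun_prop), lintegral_add_left (by fun_prop)]
  exact ENNReal.mul_lt_top (by norm_num) (ENNReal.add_lt_top.mpr ⟨hN2.lt_top, hQ1.lt_top⟩)

theorem HasWeakGradient.congr_ae {u u' : R3 → ℝ} {G G' : R3 → R3} (h : HasWeakGradient u G)
    (hu : u =ᵐ[volume] u') (hG : G =ᵐ[volume] G') : HasWeakGradient u' G' := by
  refine ⟨h.locallyIntegrable.congr hu, h.locallyIntegrable_grad.congr hG, ?_⟩
  intro φ hφ hφc v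
  have h1 : ∫ x, u' x * fderiv ℝ φ x v = ∫ x, u x * fderiv ℝ φ x v :=
    integral_congr_ae (by filter_upwards [hu] with x hx; rw [hx])
  have h2 : ∫ x, inner ℝ (G' x) v * φ x = ∫ x, inner ℝ (G x) v * φ x :=
    integral_congr_ae (by filter_upwards [hG] with x hx; rw [hx])
  rw [h1, h2]
  exact h.integral_eq φ hφ hφc v

theorem coulombEnergy_congr_ae {u u' : R3 → ℝ} (hu : u =ᵐ[volume] u') :
    coulombEnergy u = coulombEnergy u' := by
  refine lintegral_congr_ae ?_
  filter_upwards [hu] with x hx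
  refine lintegral_congr_ae ?_
  filter_upwards [hu] with y hy
  rw [hx, hy]

theorem memLp_three_of_mem_spaceE {u : R3 → ℝ} (hu : u ∈ spaceE) : MemLp u 3 volume := by
  obtain ⟨⟨hu6, G, hG, hG2⟩, hE⟩ := hu
  have hum := hu6.aestronglyMeasurable
  have hGm := hG2.aestronglyMeasurable
  have hlt : ∫⁻ x, ‖hGm.mk G x‖ₑ ^ 2 ≠ ⊤ := by
    have h1 := (eLpNorm_lt_top_iff_lintegral_rpow_enorm_lt_top (by norm_num) (by norm_num)).mp
      ((memLp_congr_ae hGm.ae_eq_mk).mp hG2).2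
    refine ne_of_lt ?_
    simpa using h1
  have h3 := (hG.congr_ae hum.ae_eq_mk hGm.ae_eq_mk).lintegral_enorm_cube_lt_top
    hum.stronglyMeasurable_mk.measurable hGm.stronglyMeasurable_mk.measurable hlt
    (by rw [← coulombEnergy_congr_ae hum.ae_eq_mk]; exact hE.ne)
  refine (memLp_congr_ae hum.ae_eq_mk).mpr ⟨hum.stronglyMeasurable_mk.aestronglyMeasurable, ?_⟩
  rw [eLpNorm_lt_top_iff_lintegral_rpow_enorm_lt_top (by norm_num) (by norm_num)]
  simpa using h3

/-- Pointwise `|u|^p ≤ |u|³ + |u|⁶`, according to whether `|u| ≤ 1`. -/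
theorem memLp_of_memLp_three_of_memLp_six {u : R3 → ℝ} (h3 : MemLp u 3 volume)
    (h6 : MemLp u 6 volume) {p : ℝ≥0∞} (hp3 : 3 ≤ p) (hp6 : p < 6) : MemLp u p volume := by
  have hp0 : p ≠ 0 := (lt_of_lt_of_le (by norm_num) hp3).ne'
  have hpt : p ≠ ⊤ := (hp6.trans (by norm_num)).ne
  have hq3 : (3 : ℝ) ≤ p.toReal := by
    simpa using ENNReal.toReal_mono hpt hp3
  have hq6 : p.toReal ≤ 6 := by
    simpa using ENNReal.toReal_mono (by norm_num) hp6.le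
  have h3' := (eLpNorm_lt_top_iff_lintegral_rpow_enorm_lt_top (by norm_num) (by norm_num)).mp h3.2
  have h6' := (eLpNorm_lt_top_iff_lintegral_rpow_enorm_lt_top (by norm_num) (by norm_num)).mp h6.2
  refine ⟨h3.1, ?_⟩
  rw [eLpNorm_lt_top_iff_lintegral_rpow_enorm_lt_top hp0 hpt]
  refine lt_of_le_of_lt (lintegral_mono (g := fun x => ‖u x‖ₑ ^ (3 : ℝ≥0∞).toReal
    + ‖u x‖ₑ ^ (6 : ℝ≥0∞).toReal) fun x => ?_) ?_
  · simp only [ENNReal.toReal_ofNat]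
    rcases le_total ‖u x‖ₑ 1 with h | h
    · exact le_add_right (ENNReal.rpow_le_rpow_of_exponent_ge h hq3)
    · exact le_add_left (ENNReal.rpow_le_rpow_of_exponent_le h hq6)
  · rw [lintegral_add_left' (by
      exact (h3.1.aemeasurable.enorm.pow_const _))]
    exact ENNReal.add_lt_top.mpr ⟨h3', h6'⟩

theorem spaceE_subset_spaceLp {p : ℝ≥0∞} (hp3 : 3 ≤ p) (hp6 : p < 6) : spaceE ⊆ spaceLp p :=
  fun _ hu => memLp_of_memLp_three_of_memLp_six (memLp_three_of_mem_spaceE hu) hu.1.1 hp3 hp6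

/-! ### The counterexample: rescaled bumps with distant centres. -/

/-- Centres marching off to infinity along the first axis. -/
noncomputable def farCenter (n : ℕ) : R3 := EuclideanSpace.single 0 (8 * 4 ^ n)

theorem dist_farCenter (n m : ℕ) :
    dist (farCenter n) (farCenter m) = |8 * 4 ^ n - 8 * (4 : ℝ) ^ m| := by
  unfold farCenter
  exact PiLp.dist_single_same 2 (fun _ : Fin 3 => ℝ) 0 _ _

/-- For `m < n` the centres are at least `6 · 4^n` apart, while the radii are at most `2 · 4^n` and
`2 · 4^m`. The product form of the bound makes the mutual energies factor into geometric series. -/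
theorem two_pow_mul_two_pow_le_dist {R : ℕ → ℝ} (hR : ∀ n, R n ≤ n + 1) {n m : ℕ}
    (hnm : n ≠ m) {x y : R3} (hx : x ∈ Metric.closedBall (farCenter n) (2 * R n))
    (hy : y ∈ Metric.closedBall (farCenter m) (2 * R m)) : (2 : ℝ) ^ n * 2 ^ m ≤ dist x y := by
  wlog hlt : m < n generalizing n m x y
  · rw [mul_comm, dist_comm]
    exact this hnm.symm hy hx (lt_of_le_of_ne (not_lt.mp hlt) hnm)
  rw [Metric.mem_closedBall] at hx hy
  have h4 : (4 : ℝ) * 4 ^ m ≤ 4 ^ n := by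
    rw [← pow_succ']
    exact pow_le_pow_right₀ (by norm_num) hlt
  have hn : (n : ℝ) + 1 ≤ 4 ^ n := by
    have : n + 1 ≤ 4 ^ n := (Nat.lt_pow_self (by norm_num) : n < 4 ^ n)
    exact_mod_cast this
  have hm : (m : ℝ) + 1 ≤ 4 ^ m := by
    have : m + 1 ≤ 4 ^ m := (Nat.lt_pow_self (by norm_num) : m < 4 ^ m)
    exact_mod_cast this
  have h2 : (2 : ℝ) ^ n * 2 ^ m ≤ 4 ^ n := by
    calc (2 : ℝ) ^ n * 2 ^ m ≤ 2 ^ n * 2 ^ n := by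
          gcongr
          norm_num
      _ = 4 ^ n := by rw [← mul_pow]; norm_num
  have hpos : (0 : ℝ) < 4 ^ m := by positivity
  have hc : 8 * (4 : ℝ) ^ n - 8 * 4 ^ m ≤ dist (farCenter n) (farCenter m) := by
    rw [dist_farCenter]; exact le_abs_self _
  have htri : dist (farCenter n) (farCenter m)
      ≤ dist x (farCenter n) + dist x y + dist y (farCenter m) := by
    rw [dist_comm x (farCenter n)]
    exact dist_triangle4 _ _ _ _
  linarith [hR n, hR m]

/-- A smooth function equal to `1` on the unit ball and vanishing outside the ball of radius `2`. -/
noncomputable def unitBump : ContDiffBump (0 : R3) := ⟨1, 2, one_pos, one_lt_two⟩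

/-- The bump at scale `r` about `c`, of height `r⁻²`. -/
noncomputable def scaledBump (r : ℝ) (c x : R3) : ℝ := (r ^ 2)⁻¹ * unitBump (r⁻¹ • (x - c))

theorem contDiff_scaledBump (r : ℝ) (c : R3) : ContDiff ℝ ∞ (scaledBump r c) :=
  contDiff_const.mul (unitBump.contDiff.comp (by fun_prop))

theorem norm_scaledBump_le (r : ℝ) (c x : R3) : ‖scaledBump r c x‖ ≤ (r ^ 2)⁻¹ := by
  unfold scaledBump
  rw [norm_mul, Real.norm_of_nonneg unitBump.nonneg, Real.norm_of_nonneg (by positivity)]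
  exact mul_le_of_le_one_right (by positivity) unitBump.le_one

theorem scaledBump_eq_of_mem {r : ℝ} (hr : 0 < r) {c x : R3} (hx : x ∈ Metric.closedBall c r) :
    scaledBump r c x = (r ^ 2)⁻¹ := by
  unfold scaledBump
  rw [unitBump.one_of_mem_closedBall, mul_one]
  rw [Metric.mem_closedBall, dist_eq_norm] at hx
  rw [mem_closedBall_zero_iff, norm_smul, norm_inv, Real.norm_of_nonneg hr.le,
    inv_mul_le_iff₀ hr, show unitBump.rIn = 1 from rfl, mul_one]
  exact hx

theorem scaledBump_eq_zero {r : ℝ} (hr : 0 < r) {c x : R3}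
    (hx : x ∉ Metric.closedBall c (2 * r)) : scaledBump r c x = 0 := by
  unfold scaledBump
  rw [unitBump.zero_of_le_dist, mul_zero]
  rw [Metric.mem_closedBall, dist_eq_norm, not_le] at hx
  rw [dist_zero_right, norm_smul, norm_inv, Real.norm_of_nonneg hr.le,
    show unitBump.rOut = 2 from rfl, le_inv_mul_iff₀ hr]
  linarith

theorem fderiv_scaledBump_eq_zero {r : ℝ} (hr : 0 < r) {c x : R3}
    (hx : x ∉ Metric.closedBall c (2 * r)) : fderiv ℝ (scaledBump r c) x = 0 := by
  have h : scaledBump r c =ᶠ[nhds x] fun _ => 0 := by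
    filter_upwards [Metric.isClosed_closedBall.isOpen_compl.mem_nhds hx] with y hy
    exact scaledBump_eq_zero hr hy
  rw [h.fderiv_eq]
  simp

/-- The chain rule costs one more factor `r⁻¹`; `K` bounds the derivative of the unit bump, hence
does not depend on `r` or `c`. -/
theorem exists_norm_fderiv_scaledBump_le :
    ∃ K : ℝ, ∀ (r : ℝ), 0 < r → ∀ c x : R3, ‖fderiv ℝ (scaledBump r c) x‖ ≤ K * (r ^ 3)⁻¹ := by
  have hψ : ContDiff ℝ 1 (unitBump : R3 → ℝ) := unitBump.contDiff
  obtain ⟨K, hK⟩ := (hψ.continuous_fderiv one_ne_zero).bounded_above_of_compact_support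
    (unitBump.hasCompactSupport.fderiv (𝕜 := ℝ))
  refine ⟨K, fun r hr c x => ?_⟩
  have h1 : HasFDerivAt (fun y : R3 => r⁻¹ • (y - c)) (r⁻¹ • ContinuousLinearMap.id ℝ R3) x :=
    ((hasFDerivAt_id x).sub_const c).const_smul r⁻¹
  have h2 := (((hψ.differentiable one_ne_zero (r⁻¹ • (x - c))).hasFDerivAt).comp x h1).const_mul
    (r ^ 2)⁻¹
  have h3 : HasFDerivAt (scaledBump r c) ((r ^ 2)⁻¹ • (fderiv ℝ unitBump (r⁻¹ • (x - c))).comp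
      (r⁻¹ • ContinuousLinearMap.id ℝ R3)) x := h2
  rw [h3.fderiv, ContinuousLinearMap.comp_smul, ContinuousLinearMap.comp_id, smul_smul, norm_smul,
    Real.norm_of_nonneg (by positivity)]
  calc (r ^ 2)⁻¹ * r⁻¹ * ‖fderiv ℝ unitBump (r⁻¹ • (x - c))‖
      ≤ (r ^ 2)⁻¹ * r⁻¹ * K := by gcongr; exact hK _
    _ = K * (r ^ 3)⁻¹ := by rw [← mul_inv, ← pow_succ, mul_comm]

/-- A superposition of far apart bumps with radii `R n`. -/
noncomputable def bumpSeries (R : ℕ → ℝ) (x : R3) : ℝ := ∑' n, scaledBump (R n) (farCenter n) x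

theorem bumpSeries_eq_of_mem {R : ℕ → ℝ} (h0 : ∀ n, 0 < R n) (hR : ∀ n, R n ≤ n + 1) {n : ℕ}
    {x : R3} (hx : x ∈ Metric.closedBall (farCenter n) (2 * R n)) :
    bumpSeries R x = scaledBump (R n) (farCenter n) x := by
  refine tsum_eq_single n fun m hm => ?_
  refine scaledBump_eq_zero (h0 m) fun hx' => ?_
  have := two_pow_mul_two_pow_le_dist hR hm hx' hx
  rw [dist_self] at this
  have : (0 : ℝ) < 2 ^ m * 2 ^ n := by positivity
  linarith

/-- Distinct support balls are at distance at least `1`, so a ball of radius `1/2` meets at most one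
of them. -/
theorem bumpSeries_eventuallyEq {R : ℕ → ℝ} (h0 : ∀ n, 0 < R n) (hR : ∀ n, R n ≤ n + 1)
    (x : R3) : ∃ n, bumpSeries R =ᶠ[nhds x] scaledBump (R n) (farCenter n) := by
  have hball : Metric.ball x (1 / 2) ∈ nhds x := Metric.ball_mem_nhds _ (by norm_num)
  by_cases h : ∃ n, ∃ y ∈ Metric.ball x (1 / 2), y ∈ Metric.closedBall (farCenter n) (2 * R n)
  · obtain ⟨n, y, hy, hyn⟩ := h
    refine ⟨n, ?_⟩
    filter_upwards [hball] with z hz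
    refine tsum_eq_single n fun m hm => scaledBump_eq_zero (h0 m) fun hz' => ?_
    have h1 := two_pow_mul_two_pow_le_dist hR hm hz' hyn
    have h2 : (1 : ℝ) ≤ 2 ^ m * 2 ^ n :=
      one_le_mul_of_one_le_of_one_le (one_le_pow₀ (by norm_num)) (one_le_pow₀ (by norm_num))
    have h3 := dist_triangle_right z y x
    rw [Metric.mem_ball] at hy hz
    linarith
  · push Not at h
    -- No support is met, so all bumps vanish nearby and any index would do.
    refine ⟨0, ?_⟩
    filter_upwards [hball] with z hz
    exact tsum_eq_single 0 fun m _ => scaledBump_eq_zero (h0 m) (h m z hz)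

theorem contDiff_bumpSeries {R : ℕ → ℝ} (h0 : ∀ n, 0 < R n) (hR : ∀ n, R n ≤ n + 1) :
    ContDiff ℝ ∞ (bumpSeries R) := by
  rw [contDiff_iff_contDiffAt]
  intro x
  obtain ⟨n, hn⟩ := bumpSeries_eventuallyEq h0 hR x
  exact ((contDiff_scaledBump _ _).contDiffAt).congr_of_eventuallyEq hn

/-- A closed ball containing the support of the `n`-th bump. -/
noncomputable def supportBall (R : ℕ → ℝ) (n : ℕ) : Set R3 :=
  Metric.closedBall (farCenter n) (2 * R n)

theorem measurableSet_supportBall (R : ℕ → ℝ) (n : ℕ) : MeasurableSet (supportBall R n) :=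
  Metric.isClosed_closedBall.measurableSet

theorem volume_supportBall {R : ℕ → ℝ} (h0 : ∀ n, 0 < R n) (n : ℕ) :
    volume (supportBall R n) = ENNReal.ofReal (8 * R n ^ 3) * volume (Metric.ball (0 : R3) 1) := by
  have := h0 n
  rw [supportBall, Measure.addHaar_closedBall _ _ (by positivity), finrank_euclideanSpace_fin,
    mul_pow]
  norm_num

/-- At most one bump is nonzero at each point, so a power of the sum has no cross terms. -/
theorem enorm_bumpSeries_pow_le {R : ℕ → ℝ} (h0 : ∀ n, 0 < R n) (hR : ∀ n, R n ≤ n + 1)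
    {j : ℕ} (hj : j ≠ 0) (x : R3) : ‖bumpSeries R x‖ₑ ^ j ≤
      ∑' n, (supportBall R n).indicator (fun _ => ENNReal.ofReal ((R n ^ (2 * j))⁻¹)) x := by
  obtain ⟨n, hn⟩ := bumpSeries_eventuallyEq h0 hR x
  refine le_trans ?_ (ENNReal.le_tsum n)
  rw [hn.eq_of_nhds]
  by_cases hx : x ∈ supportBall R n
  · rw [Set.indicator_of_mem hx, ← ofReal_norm, ← ENNReal.ofReal_pow (norm_nonneg _)]
    refine ENNReal.ofReal_le_ofReal ?_
    rw [pow_mul, ← inv_pow]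
    gcongr
    exact norm_scaledBump_le _ _ _
  · rw [scaledBump_eq_zero (h0 n) hx]
    simp [hj]

theorem exists_enorm_fderiv_bumpSeries_sq_le {R : ℕ → ℝ} (h0 : ∀ n, 0 < R n)
    (hR : ∀ n, R n ≤ n + 1) : ∃ K : ℝ, ∀ x, ‖fderiv ℝ (bumpSeries R) x‖ₑ ^ 2 ≤
      ∑' n, (supportBall R n).indicator (fun _ => ENNReal.ofReal (K ^ 2 * (R n ^ 6)⁻¹)) x := by
  obtain ⟨K, hK⟩ := exists_norm_fderiv_scaledBump_le
  refine ⟨K, fun x => ?_⟩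
  obtain ⟨n, hn⟩ := bumpSeries_eventuallyEq h0 hR x
  refine le_trans ?_ (ENNReal.le_tsum n)
  rw [hn.fderiv_eq]
  by_cases hx : x ∈ supportBall R n
  · rw [Set.indicator_of_mem hx, ← ofReal_norm, ← ENNReal.ofReal_pow (norm_nonneg _)]
    refine ENNReal.ofReal_le_ofReal ?_
    calc _ ≤ (K * (R n ^ 3)⁻¹) ^ 2 := by
          gcongr
          exact hK _ (h0 n) _ _
      _ = _ := by rw [mul_pow, inv_pow, ← pow_mul]
  · rw [fderiv_scaledBump_eq_zero (h0 n) hx, ← ofReal_norm, norm_zero, ENNReal.ofReal_zero,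
      zero_pow two_ne_zero]
    exact zero_le

theorem lintegral_tsum_indicator_supportBall {R : ℕ → ℝ} (h0 : ∀ n, 0 < R n) (a : ℕ → ℝ)
    (ha : ∀ n, 0 ≤ a n) :
    ∫⁻ x, ∑' n, (supportBall R n).indicator (fun _ => ENNReal.ofReal (a n)) x
      = (∑' n, ENNReal.ofReal (a n * (8 * R n ^ 3))) * volume (Metric.ball (0 : R3) 1) := by
  rw [lintegral_tsum fun n =>
    (measurable_const.indicator (measurableSet_supportBall R n)).aemeasurable,
    ← ENNReal.tsum_mul_right]
  refine tsum_congr fun n => ?_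
  rw [lintegral_indicator (measurableSet_supportBall R n), setLIntegral_const,
    volume_supportBall h0, ENNReal.ofReal_mul (ha n), mul_assoc]

/-- Each ball has volume of order `(R n)³`, so `j = 6` yields `(R n)^(-3)`, and larger `j` only
helps because `R n ≥ 1`. The gradient uses `j = 6`, the `L⁶` norm `j = 12`. -/
theorem lintegral_tsum_indicator_supportBall_lt_top {R : ℕ → ℝ} (h1 : ∀ n, 1 ≤ R n)
    (hsum : Summable fun n => (R n ^ 3)⁻¹) {K : ℝ} (hK : 0 ≤ K) {j : ℕ} (hj : 6 ≤ j) :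
    ∫⁻ x, ∑' n, (supportBall R n).indicator
      (fun _ => ENNReal.ofReal (K * (R n ^ j)⁻¹)) x < ⊤ := by
  have h0 : ∀ n, 0 < R n := fun n => one_pos.trans_le (h1 n)
  rw [lintegral_tsum_indicator_supportBall h0 _ fun n => by
    have := h0 n
    positivity]
  refine ENNReal.mul_lt_top (Summable.tsum_ofReal_lt_top ?_) (volume_ball_ne_top _ _).lt_top
  refine Summable.of_nonneg_of_le (fun n => ?_) (fun n => ?_) (hsum.mul_left (8 * K))
  · have := h0 n
    positivity
  · have := h0 n
    have h6 : R n ^ 6 ≤ R n ^ j := pow_le_pow_right₀ (h1 n) hj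
    calc K * (R n ^ j)⁻¹ * (8 * R n ^ 3) ≤ K * (R n ^ 6)⁻¹ * (8 * R n ^ 3) := by gcongr
      _ = 8 * K * (R n ^ 3)⁻¹ := by
        field_simp

/-- Integration by parts; compact support of the test function makes all the products integrable. -/
theorem hasWeakGradient_of_contDiff {u : R3 → ℝ} (hu : ContDiff ℝ 1 u) :
    HasWeakGradient u fun x => (InnerProductSpace.toDual ℝ R3).symm (fderiv ℝ u x) := by
  have hfd := hu.continuous_fderiv one_ne_zero
  have hG : Continuous fun x => (InnerProductSpace.toDual ℝ R3).symm (fderiv ℝ u x) :=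
    (LinearIsometryEquiv.continuous _).comp hfd
  refine ⟨hu.continuous.locallyIntegrable, hG.locallyIntegrable, ?_⟩
  intro φ hφ hφc v
  simp only [InnerProductSpace.toDual_symm_apply]
  have hφd : Continuous fun x => fderiv ℝ φ x v :=
    (hφ.continuous_fderiv (by simp)).clm_apply continuous_const
  have hφdc : HasCompactSupport fun x => fderiv ℝ φ x v := hφc.fderiv_apply (𝕜 := ℝ) v
  refine integral_mul_fderiv_eq_neg_fderiv_mul_of_integrable ?_ ?_ ?_
    (fun x _ => hu.differentiable one_ne_zero x) (fun x _ => hφ.differentiable (by simp) x)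
  · exact ((hfd.clm_apply continuous_const).mul hφ.continuous).integrable_of_hasCompactSupport
      hφc.mul_left
  · exact (hu.continuous.mul hφd).integrable_of_hasCompactSupport hφdc.mul_left
  · exact (hu.continuous.mul hφ.continuous).integrable_of_hasCompactSupport hφc.mul_left

theorem bumpSeries_mem_spaceD12 {R : ℕ → ℝ} (h1 : ∀ n, 1 ≤ R n) (hR : ∀ n, R n ≤ n + 1)
    (hsum : Summable fun n => (R n ^ 3)⁻¹) : bumpSeries R ∈ spaceD12 := by
  have h0 : ∀ n, 0 < R n := fun n => one_pos.trans_le (h1 n)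
  have hu : ContDiff ℝ 1 (bumpSeries R) :=
    (contDiff_bumpSeries h0 hR).of_le (by exact_mod_cast le_top)
  refine ⟨⟨hu.continuous.aestronglyMeasurable, ?_⟩, _, hasWeakGradient_of_contDiff hu,
    ((LinearIsometryEquiv.continuous _).comp
      (hu.continuous_fderiv one_ne_zero)).aestronglyMeasurable, ?_⟩
  · rw [eLpNorm_lt_top_iff_lintegral_rpow_enorm_lt_top (by norm_num) (by norm_num)]
    refine lt_of_le_of_lt (lintegral_mono fun x => ?_)
      (lintegral_tsum_indicator_supportBall_lt_top h1 hsum zero_le_one (j := 12) (by norm_num))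
    have := enorm_bumpSeries_pow_le h0 hR (j := 6) (by norm_num) x
    simpa using this
  · rw [eLpNorm_lt_top_iff_lintegral_rpow_enorm_lt_top (by norm_num) (by norm_num)]
    obtain ⟨K, hK⟩ := exists_enorm_fderiv_bumpSeries_sq_le h0 hR
    refine lt_of_le_of_lt (lintegral_mono fun x => ?_)
      (lintegral_tsum_indicator_supportBall_lt_top h1 hsum (sq_nonneg K) (j := 6) le_rfl)
    have := hK x
    simpa [← ofReal_norm] using this

/-! ### Coulomb energy of the bump series. -/

/-- In polar coordinates the integrand becomes `y² · y⁻¹ = y` on `(0, 1)`. -/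
theorem lintegral_inv_enorm_ballMeasure_one_ne_top : ∫⁻ z, ‖z‖ₑ⁻¹ ∂ballMeasure 1 ≠ ⊤ := by
  have hInt : IntegrableOn (fun z : R3 => ‖z‖⁻¹) (Metric.ball 0 1) volume := by
    rw [integrableOn_fun_norm_addHaar volume (f := fun y : ℝ => y⁻¹), finrank_euclideanSpace_fin]
    have h1 : IntegrableOn (fun y : ℝ => y) (Set.Ioo 0 1) volume :=
      (continuous_id.integrableOn_Icc).mono_set Set.Ioo_subset_Icc_self
    refine h1.congr_fun (fun y hy => ?_) measurableSet_Ioo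
    have : y ≠ 0 := hy.1.ne'
    simp only [smul_eq_mul]
    field_simp
  unfold ballMeasure
  rw [lintegral_smul_measure, smul_eq_mul]
  refine ENNReal.mul_ne_top (ENNReal.inv_ne_top.mpr (volume_ball_ne_zero _ one_pos)) ?_
  refine ne_of_lt (lt_of_le_of_lt (le_of_eq ?_) hInt.2)
  have hae : ∀ᵐ z : R3 ∂volume.restrict (Metric.ball 0 1), z ≠ 0 :=
    ae_restrict_of_ae (by simp [ae_iff, measure_singleton])
  refine lintegral_congr_ae ?_
  filter_upwards [hae] with z hz
  rw [enorm_inv (norm_ne_zero_iff.mpr hz), enorm_norm]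

theorem setLIntegral_inv_edist_ball {t : ℝ} (ht : 0 < t) (x : R3) :
    ∫⁻ y in Metric.ball x t, (edist x y)⁻¹
      = volume (Metric.ball x t) * ((ENNReal.ofReal t)⁻¹ * ∫⁻ z, ‖z‖ₑ⁻¹ ∂ballMeasure 1) := by
  have h := lintegral_ballMeasure_comp_smul ht one_pos (g := fun y => (edist x y)⁻¹)
    (by fun_prop) x
  rw [mul_one, avgBy_ballMeasure] at h
  have h1 : ∀ z : R3, (edist x (x + t • z))⁻¹ = (ENNReal.ofReal t)⁻¹ * ‖z‖ₑ⁻¹ := by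
    intro z
    rw [edist_comm, edist_eq_enorm_sub, add_sub_cancel_left, enorm_smul,
      Real.enorm_of_nonneg ht.le, ENNReal.mul_inv (Or.inl (by simpa using ht))
        (Or.inl ENNReal.ofReal_ne_top)]
  simp only [h1] at h
  rw [lintegral_const_mul _ (by fun_prop)] at h
  rw [h, ← mul_assoc, ENNReal.mul_inv_cancel (volume_ball_ne_zero _ ht) (volume_ball_ne_top _ _),
    one_mul]

/-- The support ball has diameter `4 R n`, hence lies in `B(x, 5 R n)`; scaling then gives `5³ / 5 =
25`. -/
theorem setLIntegral_inv_edist_supportBall_le {R : ℕ → ℝ} (h0 : ∀ n, 0 < R n) {n : ℕ} {x : R3}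
    (hx : x ∈ supportBall R n) :
    ∫⁻ y in supportBall R n, (edist x y)⁻¹ ≤ ENNReal.ofReal (25 * R n ^ 2) *
      (volume (Metric.ball (0 : R3) 1) * ∫⁻ z, ‖z‖ₑ⁻¹ ∂ballMeasure 1) := by
  have hr := h0 n
  have hsub : supportBall R n ⊆ Metric.ball x (5 * R n) := by
    intro y hy
    rw [supportBall, Metric.mem_closedBall] at hx hy
    rw [Metric.mem_ball]
    have := dist_triangle_right y x (farCenter n)
    linarith
  refine (lintegral_mono_set hsub).trans (le_of_eq ?_)
  rw [setLIntegral_inv_edist_ball (by positivity), ← mul_one (5 * R n),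
    volume_ball_mul x 0 (by positivity) zero_le_one, ← ENNReal.ofReal_inv_of_pos (by positivity),
    mul_mul_mul_comm, ← ENNReal.ofReal_mul (by positivity)]
  congr 2
  field_simp
  norm_num

theorem setLIntegral_inv_edist_supportBall_of_ne_le {R : ℕ → ℝ} (h0 : ∀ n, 0 < R n)
    (hR : ∀ n, R n ≤ n + 1) {n m : ℕ} (hnm : n ≠ m) {x : R3} (hx : x ∈ supportBall R n) :
    ∫⁻ y in supportBall R m, (edist x y)⁻¹ ≤ ENNReal.ofReal ((1 / 2) ^ n * (1 / 2) ^ m *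
      (8 * R m ^ 3)) * volume (Metric.ball (0 : R3) 1) := by
  calc ∫⁻ y in supportBall R m, (edist x y)⁻¹
      ≤ ∫⁻ _ in supportBall R m, ENNReal.ofReal ((1 / 2) ^ n * (1 / 2) ^ m) := by
        refine setLIntegral_mono' (measurableSet_supportBall R m) fun y hy => ?_
        have h1 := two_pow_mul_two_pow_le_dist hR hnm hx hy
        rw [one_div, inv_pow, inv_pow, ← mul_inv, ENNReal.ofReal_inv_of_pos (by positivity),
          edist_dist]
        exact ENNReal.inv_le_inv.mpr (ENNReal.ofReal_le_ofReal h1)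
    _ = _ := by
        rw [setLIntegral_const, volume_supportBall h0, ← mul_assoc,
          ← ENNReal.ofReal_mul (by positivity)]

/-- Expand both factors over the bumps. A pair contributes its two squared heights, the volume of
the first support, and a bound `C` for the potential of the second support on the first. -/
theorem coulombEnergy_bumpSeries_le {R : ℕ → ℝ} (h0 : ∀ n, 0 < R n) (hR : ∀ n, R n ≤ n + 1)
    {C : ℕ × ℕ → ℝ≥0∞} (hC : ∀ p : ℕ × ℕ, ∀ x ∈ supportBall R p.1,
      ∫⁻ y in supportBall R p.2, (edist x y)⁻¹ ≤ C p) :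
    coulombEnergy (bumpSeries R) ≤ ∑' p : ℕ × ℕ, ENNReal.ofReal ((R p.1 ^ 4)⁻¹ * (R p.2 ^ 4)⁻¹ *
      (8 * R p.1 ^ 3)) * volume (Metric.ball (0 : R3) 1) * C p := by
  set f : ℕ → R3 → ℝ≥0∞ := fun n =>
    (supportBall R n).indicator (fun _ => ENNReal.ofReal ((R n ^ 4)⁻¹))
  have hf : ∀ n, Measurable (f n) := fun n =>
    measurable_const.indicator (measurableSet_supportBall R n)
  have hu : ∀ x, ‖bumpSeries R x‖ₑ ^ 2 ≤ ∑' n, f n x := fun x =>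
    enorm_bumpSeries_pow_le h0 hR two_ne_zero x
  have hm : ∀ p : ℕ × ℕ, Measurable fun q : R3 × R3 =>
      f p.1 q.1 * f p.2 q.2 * (edist q.1 q.2)⁻¹ := fun p =>
    (((hf p.1).comp measurable_fst).mul ((hf p.2).comp measurable_snd)).mul (by fun_prop)
  rw [coulombEnergy_eq_lintegral]
  calc ∫⁻ x, ∫⁻ y, ‖bumpSeries R x‖ₑ ^ 2 * ‖bumpSeries R y‖ₑ ^ 2 * (edist x y)⁻¹
      ≤ ∫⁻ x, ∫⁻ y, ∑' p : ℕ × ℕ, f p.1 x * f p.2 y * (edist x y)⁻¹ := by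
        refine lintegral_mono fun x => lintegral_mono fun y => ?_
        simp only
        rw [ENNReal.tsum_mul_right, ENNReal.tsum_prod']
        simp only [ENNReal.tsum_mul_left, ENNReal.tsum_mul_right]
        gcongr
        · exact hu x
        · exact hu y
    _ = ∑' p : ℕ × ℕ, ∫⁻ x, ∫⁻ y, f p.1 x * f p.2 y * (edist x y)⁻¹ := by
        rw [← lintegral_tsum fun p => ((hm p).lintegral_prod_right').aemeasurable]
        refine lintegral_congr fun x => ?_
        exact lintegral_tsum fun p => ((hm p).comp measurable_prodMk_left).aemeasurable
    _ ≤ _ := by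
        refine ENNReal.tsum_le_tsum fun p => ?_
        have hr := h0 p.1
        have hr' := h0 p.2
        calc ∫⁻ x, ∫⁻ y, f p.1 x * f p.2 y * (edist x y)⁻¹
            ≤ ∫⁻ x, (supportBall R p.1).indicator (fun _ =>
                ENNReal.ofReal ((R p.1 ^ 4)⁻¹) * (ENNReal.ofReal ((R p.2 ^ 4)⁻¹) * C p)) x := by
              refine lintegral_mono fun x => ?_
              by_cases hx : x ∈ supportBall R p.1
              · have h1 : ∀ y, f p.1 x * f p.2 y * (edist x y)⁻¹
                    = ENNReal.ofReal ((R p.1 ^ 4)⁻¹) * (ENNReal.ofReal ((R p.2 ^ 4)⁻¹) *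
                      (supportBall R p.2).indicator (fun y => (edist x y)⁻¹) y) := by
                  intro y
                  simp only [f, Set.indicator_of_mem hx]
                  by_cases hy : y ∈ supportBall R p.2
                  · simp only [Set.indicator_of_mem hy, mul_assoc]
                  · simp only [Set.indicator_of_notMem hy, mul_zero, zero_mul]
                have hmi : Measurable
                    ((supportBall R p.2).indicator (fun y => (edist x y)⁻¹)) :=
                  Measurable.indicator (by fun_prop) (measurableSet_supportBall R p.2)
                simp only [h1, Set.indicator_of_mem hx]
                rw [lintegral_const_mul _ (hmi.const_mul _), lintegral_const_mul _ hmi,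
                  lintegral_indicator (measurableSet_supportBall R p.2)]
                gcongr
                exact hC p x hx
              · simp only [f, Set.indicator_of_notMem hx, zero_mul, lintegral_zero, le_refl]
          _ = _ := by
              rw [lintegral_indicator (measurableSet_supportBall R p.1), setLIntegral_const,
                volume_supportBall h0, ENNReal.ofReal_mul (p := _ * _) (by positivity),
                ENNReal.ofReal_mul (p := (R p.1 ^ 4)⁻¹) (by positivity)]
              ring

theorem coulombEnergy_bumpSeries_lt_top {R : ℕ → ℝ} (h1 : ∀ n, 1 ≤ R n) (hR : ∀ n, R n ≤ n + 1)
    (hsum : Summable fun n => (R n ^ 3)⁻¹) : coulombEnergy (bumpSeries R) < ⊤ := by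
  have h0 : ∀ n, 0 < R n := fun n => one_pos.trans_le (h1 n)
  set v := volume (Metric.ball (0 : R3) 1)
  set J := ∫⁻ z, ‖z‖ₑ⁻¹ ∂ballMeasure 1
  have hv : v < ⊤ := (volume_ball_ne_top _ _).lt_top
  have hJ : J < ⊤ := lintegral_inv_enorm_ballMeasure_one_ne_top.lt_top
  refine (coulombEnergy_bumpSeries_le h0 hR (C := fun p => if p.1 = p.2 then
    ENNReal.ofReal (25 * R p.1 ^ 2) * (v * J) else
    ENNReal.ofReal ((1 / 2) ^ p.1 * (1 / 2) ^ p.2 * (8 * R p.2 ^ 3)) * v) ?_).trans_lt ?_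
  · rintro ⟨n, m⟩ x hx
    simp only at hx ⊢
    split_ifs with h
    · subst h
      exact setLIntegral_inv_edist_supportBall_le h0 hx
    · exact setLIntegral_inv_edist_supportBall_of_ne_le h0 hR h hx
  -- Diagonal: `8 · 25 = 200` and `(R n)^(-8+3+2) = (R n)^(-3)`. Off the diagonal the powers leave
  -- `(R n)⁻¹ (R m)⁻¹ ≤ 1`, and the separation supplies geometric factors.
  have hterm : ∀ p : ℕ × ℕ, ENNReal.ofReal ((R p.1 ^ 4)⁻¹ * (R p.2 ^ 4)⁻¹ * (8 * R p.1 ^ 3)) * v *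
      (if p.1 = p.2 then ENNReal.ofReal (25 * R p.1 ^ 2) * (v * J) else
        ENNReal.ofReal ((1 / 2) ^ p.1 * (1 / 2) ^ p.2 * (8 * R p.2 ^ 3)) * v)
      ≤ (if p.1 = p.2 then ENNReal.ofReal (200 * (R p.1 ^ 3)⁻¹) * (v * (v * J)) else 0)
        + ENNReal.ofReal ((1 / 2) ^ p.1) * ENNReal.ofReal ((1 / 2) ^ p.2) * (64 * (v * v)) := by
    rintro ⟨n, m⟩
    have hn := h0 n
    have hm := h0 m
    simp only
    split_ifs with h
    · subst h
      refine le_add_right (le_of_eq ?_)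
      rw [mul_mul_mul_comm, ← ENNReal.ofReal_mul (by positivity)]
      congr 2
      field_simp
      norm_num
    · rw [zero_add, mul_mul_mul_comm, ← ENNReal.ofReal_mul (by positivity),
        ← ENNReal.ofReal_mul (by positivity),
        show (64 : ℝ≥0∞) = ENNReal.ofReal 64 by norm_num, ← mul_assoc _ (ENNReal.ofReal 64),
        ← ENNReal.ofReal_mul (by positivity)]
      refine mul_le_mul_left (ENNReal.ofReal_le_ofReal ?_) _
      have e : (R n ^ 4)⁻¹ * (R m ^ 4)⁻¹ * (8 * R n ^ 3) *
          ((1 / 2) ^ n * (1 / 2) ^ m * (8 * R m ^ 3))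
          = (1 / 2) ^ n * (1 / 2) ^ m * 64 * ((R n)⁻¹ * (R m)⁻¹) := by
        field_simp
        norm_num
      rw [e]
      refine mul_le_of_le_one_right (by positivity) ?_
      exact mul_le_one₀ (inv_le_one_of_one_le₀ (h1 n)) (by positivity)
        (inv_le_one_of_one_le₀ (h1 m))
  refine (ENNReal.tsum_le_tsum hterm).trans_lt ?_
  rw [ENNReal.tsum_add, ENNReal.add_lt_top, ENNReal.tsum_prod', ENNReal.tsum_prod']
  have hgeo : ∑' n : ℕ, ENNReal.ofReal ((1 / 2) ^ n) < ⊤ :=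
    Summable.tsum_ofReal_lt_top (summable_geometric_of_lt_one (by norm_num) (by norm_num))
  constructor
  · have hdiag : ∀ n : ℕ, ∑' m : ℕ, (if n = m then
        ENNReal.ofReal (200 * (R n ^ 3)⁻¹) * (v * (v * J)) else 0)
        = ENNReal.ofReal (200 * (R n ^ 3)⁻¹) * (v * (v * J)) := fun n => by
      rw [tsum_eq_single n fun m hm => if_neg hm.symm, if_pos rfl]
    simp only [hdiag]
    rw [ENNReal.tsum_mul_right]
    exact ENNReal.mul_lt_top (Summable.tsum_ofReal_lt_top (hsum.mul_left 200))
      (ENNReal.mul_lt_top hv (ENNReal.mul_lt_top hv hJ))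
  · simp only [ENNReal.tsum_mul_left, ENNReal.tsum_mul_right]
    exact ENNReal.mul_lt_top (ENNReal.mul_lt_top hgeo hgeo)
      (ENNReal.mul_lt_top (by norm_num) (ENNReal.mul_lt_top hv hv))

/-! ### Divergence in `L^p` and the choice of radii. -/

theorem tsum_ofReal_eq_top_of_not_summable {f : ℕ → ℝ} (h0 : ∀ n, 0 ≤ f n) (h : ¬ Summable f) :
    ∑' n, ENNReal.ofReal (f n) = ⊤ := by
  by_contra hne
  refine h ?_
  have := ENNReal.summable_toReal hne
  simpa only [ENNReal.toReal_ofReal (h0 _)] using this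

/-- On the disjoint inner balls the function equals `(R n)^(-2)`, and these balls alone already give
a divergent integral. -/
theorem not_memLp_bumpSeries {R : ℕ → ℝ} (h0 : ∀ n, 0 < R n) (hR : ∀ n, R n ≤ n + 1)
    {p : ℝ≥0∞} (hp0 : p ≠ 0) (hpt : p ≠ ⊤)
    (hdiv : ¬ Summable fun n => (R n ^ 2)⁻¹ ^ p.toReal * R n ^ 3) :
    ¬ MemLp (bumpSeries R) p volume := by
  intro hmem
  have hlt := (eLpNorm_lt_top_iff_lintegral_rpow_enorm_lt_top hp0 hpt).mp hmem.2
  refine hlt.ne (top_unique ?_)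
  have hsub : ∀ n, Metric.closedBall (farCenter n) (R n)
      ⊆ Metric.closedBall (farCenter n) (2 * R n) := fun n =>
    Metric.closedBall_subset_closedBall (by linarith [h0 n])
  have hdisj : Pairwise (Function.onFun Disjoint fun n => Metric.closedBall (farCenter n) (R n)) := by
    intro n m hnm
    refine Set.disjoint_left.mpr fun x hx hx' => ?_
    have := two_pow_mul_two_pow_le_dist hR hnm (hsub n hx) (hsub m hx')
    rw [dist_self] at this
    have : (0 : ℝ) < 2 ^ n * 2 ^ m := by positivity
    linarith
  calc (⊤ : ℝ≥0∞) = (∑' n, ENNReal.ofReal ((R n ^ 2)⁻¹ ^ p.toReal * R n ^ 3)) *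
        volume (Metric.ball (0 : R3) 1) := by
        rw [tsum_ofReal_eq_top_of_not_summable (fun n => by
          have := h0 n
          positivity) hdiv, ENNReal.top_mul (volume_ball_ne_zero _ one_pos)]
    _ = ∑' n, ∫⁻ x in Metric.closedBall (farCenter n) (R n), ‖bumpSeries R x‖ₑ ^ p.toReal := by
        rw [← ENNReal.tsum_mul_right]
        refine tsum_congr fun n => ?_
        have hr := h0 n
        rw [setLIntegral_congr_fun (g := fun _ => ENNReal.ofReal ((R n ^ 2)⁻¹ ^ p.toReal))
          Metric.isClosed_closedBall.measurableSet fun x hx => ?_, setLIntegral_const,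
          Measure.addHaar_closedBall _ _ hr.le, finrank_euclideanSpace_fin,
          ENNReal.ofReal_mul (by positivity), mul_assoc]
        simp only
        rw [bumpSeries_eq_of_mem h0 hR (hsub n hx), scaledBump_eq_of_mem hr hx,
          Real.enorm_of_nonneg (by positivity),
          ENNReal.ofReal_rpow_of_nonneg (by positivity) ENNReal.toReal_nonneg]
    _ = ∫⁻ x in ⋃ n, Metric.closedBall (farCenter n) (R n), ‖bumpSeries R x‖ₑ ^ p.toReal := by
        rw [lintegral_iUnion (fun n => Metric.isClosed_closedBall.measurableSet) hdisj]
    _ ≤ ∫⁻ x, ‖bumpSeries R x‖ₑ ^ p.toReal := setLIntegral_le_lintegral _ _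

/-- Radii for which the bump series lies in `E(ℝ³)` but not in `L^q(ℝ³)`. -/
theorem exists_radii {q : ℝ} (hq : q < 3) : ∃ R : ℕ → ℝ, (∀ n, 1 ≤ R n) ∧ (∀ n, R n ≤ n + 1) ∧
    (Summable fun n => (R n ^ 3)⁻¹) ∧ ¬ Summable fun n => (R n ^ 2)⁻¹ ^ q * R n ^ 3 := by
  -- Radii `(n+1)^α` with `α = 1/(2s - 3)` turn `R^(3-2s)` into the harmonic series. Taking `s ≥ 2`
  -- ensures `0 < α ≤ 1`, so the radii grow at most linearly; `s < 3` gives `3α > 1`; and `q ≤ s`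
  -- makes the terms for `q` at least as large as the harmonic ones.
  set s : ℝ := max q 2
  have hs2 : 2 ≤ s := le_max_right _ _
  have hsq : q ≤ s := le_max_left _ _
  have hs3 : s < 3 := max_lt hq (by norm_num)
  have hpos : 0 < 2 * s - 3 := by linarith
  set α : ℝ := 1 / (2 * s - 3)
  have hα0 : 0 < α := by positivity
  have hα1 : α ≤ 1 := by
    rw [div_le_one hpos]; linarith
  have hα3 : 1 < α * 3 := by
    rw [div_mul_eq_mul_div, one_lt_div hpos]; linarith
  have hαq : α * (2 * q - 3) ≤ 1 := by
    rw [div_mul_eq_mul_div, div_le_one hpos]; linarith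
  have hb : ∀ n : ℕ, (1 : ℝ) ≤ (n : ℝ) + 1 := fun n => by
    linarith [Nat.cast_nonneg (α := ℝ) n]
  have hb0 : ∀ n : ℕ, (0 : ℝ) ≤ (n : ℝ) + 1 := fun n => zero_le_one.trans (hb n)
  refine ⟨fun n => ((n : ℝ) + 1) ^ α, fun n => Real.one_le_rpow (hb n) hα0.le, fun n => ?_, ?_, ?_⟩
  · calc ((n : ℝ) + 1) ^ α ≤ ((n : ℝ) + 1) ^ (1 : ℝ) :=
        Real.rpow_le_rpow_of_exponent_le (hb n) hα1
      _ = n + 1 := Real.rpow_one _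
  · have h := (summable_nat_add_iff 1).mpr (Real.summable_nat_rpow_inv.mpr hα3)
    refine h.congr fun n => ?_
    rw [← Real.rpow_natCast (((n : ℝ) + 1) ^ α) 3, ← Real.rpow_mul (hb0 n)]
    push_cast
    rfl
  · intro hsum
    refine Real.not_summable_natCast_inv ((summable_nat_add_iff 1).mp
      (Summable.of_nonneg_of_le (fun n => by positivity) (fun n => ?_) hsum))
    have hn : (0 : ℝ) < (n : ℝ) + 1 := one_pos.trans_le (hb n)
    have e : ((((n : ℝ) + 1) ^ α) ^ 2)⁻¹ ^ q * (((n : ℝ) + 1) ^ α) ^ 3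
        = ((n : ℝ) + 1) ^ (-(α * (2 * q - 3))) := by
      rw [← Real.rpow_natCast (((n : ℝ) + 1) ^ α) 3, ← Real.rpow_natCast (((n : ℝ) + 1) ^ α) 2,
        ← Real.rpow_neg (by positivity), ← Real.rpow_mul hn.le, ← Real.rpow_mul hn.le,
        ← Real.rpow_mul hn.le, ← Real.rpow_add hn]
      congr 1
      push_cast
      ring
    rw [e]
    push_cast
    rw [← Real.rpow_neg_one]
    exact Real.rpow_le_rpow_of_exponent_le (hb n) (by linarith)

theorem not_spaceE_subset_spaceLp {p : ℝ≥0∞} (hp0 : 0 < p) (hp3 : p < 3) :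
    ¬ spaceE ⊆ spaceLp p := by
  have hpt : p ≠ ⊤ := (hp3.trans (by norm_num)).ne
  have hq : p.toReal < 3 := by
    simpa using (ENNReal.toReal_lt_toReal hpt (by norm_num)).mpr hp3
  obtain ⟨R, h1, hR, hsum, hdiv⟩ := exists_radii hq
  intro hsub
  exact not_memLp_bumpSeries (fun n => one_pos.trans_le (h1 n)) hR hp0.ne' hpt hdiv
    (hsub ⟨bumpSeries_mem_spaceD12 h1 hR hsum, coulombEnergy_bumpSeries_lt_top h1 hR hsum⟩)

theorem theorem1p5 :
    (∀ p : ℝ≥0∞, 3 ≤ p → p < 6 → spaceE ⊆ spaceLp p) ∧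
    (∀ p : ℝ≥0∞, 0 < p → p < 3 → ¬ spaceE ⊆ spaceLp p) := by
  exact ⟨fun _ => spaceE_subset_spaceLp, fun _ => not_spaceE_subset_spaceLp⟩
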